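/- For $n\ge 1$ and nonzero $r,s\in\mathbb R^n$ let $\theta_{r,s}=\angle(r,s)$, $\hat r=r/\|r\|_2$, $\hat s=s/\|s\|_2$ and $$Q_{r,s}=\frac{\pi-\theta_{r,s}}{2\pi}I_n+\frac{\sin\theta_{r,s}}{2\pi}M_{\hat r\leftrightarrow\hat s},$$ where $M_{\hat r\leftrightarrow\hat s}$ is the matrix that sends $\hat r\mapsto\hat s$, $\hat s\mapsto\hat r$ and has kernel $\mathrm{span}(\{r,s\})^\perp$; put $Q_{r,s}=0$ if $r=0$ or $s=0$. For $W\in\mathbb R^{m\times n}$ and $r\in\mathbb R^n$ let $W_{+,r}=\mathrm{diag}(Wr>0)\,W$, where $\mathrm{diag}(Wr>0)$ is the diagonal matrix whose $i$-th diagonal entry is $1$ if $(Wr)_i>0$ and $0$ otherwise. **Proposition.** There are an absolute constant $\gamma>0$ and polynomials $c$ and $C$ with real coefficients such that $c_\epsilon:=c(\epsilon)>0$ and $C_\epsilon:=C(\epsilon^{-1})>0$ for every $0<\epsilon<1$, and such that the following holds. Let $0<\epsilon<1$, let $1\le\ell<n$ and $\ell'\ge\ell$ be integers, and let $W\in\mathbb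 R^{m\times n}$ be a random matrix with i.i.d. $\mathcal N(0,1/m)$ entries. 1. Let $R,S\subset\mathbb R^n$ be fixed $\ell$-dimensional subspaces and $T\subset\mathbb R^n$ a fixed $\ell'$-dimensional subspace. If $m\ge C_\epsilon\ell'$, then with probability exceeding $$1-\gamma\Big(\frac{e\,m}{\ell}\Big)^{2\ell}e^{-c_\epsilon m}$$ one has $$\big|\langle W_{+,r}^TW_{+,s}u,v\rangle-\langle Q_{r,s}u,v\rangle\big|\le\epsilon\,\|u\|_2\|v\|_2\qquad\text{for all }u,v\in T,\ r\in R,\ s\in S.$$ 2. Let $N_1,N_2,N_3,N_4\ge1$, and let $U=\bigcup_{i=1}^{N_1}U_i$, $V=\bigcup_{j=1}^{N_2}V_j$, $R=\bigcup_{p=1}^{N_3}R_p$, $S=\bigcup_{q=1}^{N_4}S_q$ be unions of fixed subspaces of $\mathbb R^n$, where each $U_i$ and each $V_j$ has dimension at most $\ell'$ and each $R_p$ and each $S_q$ has dimension at most $\ell$. If $m\ge 2C_\epsilon\ell'$, then with probability exceeding $$1-\gamma\,N_1N_2N_3N_4\Big(\frac{e\,m}{\ell}\Big)^{2\ell}e^{-c_\epsilon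 m}$$ one has $$\big|\langle W_{+,r}^TW_{+,s}u,v\rangle-\langle Q_{r,s}u,v\rangle\big|\le\epsilon\,\|u\|_2\|v\|_2\qquad\text{for all }u\in U,\ v\in V,\ r\in R,\ s\in S.$$ -/

import Mathlib

open MeasureTheory ProbabilityTheory
open scoped Matrix

noncomputable section

namespace ReluConcentration

/-- `ℝⁿ` with its Euclidean inner product and norm. -/
abbrev E (n : ℕ) : Type := EuclideanSpace ℝ (Fin n)

/-- `W_{+,r} = diag(W r > 0) W`: the rows of `W` with `⟨w_i, r⟩ > 0` are kept,
the other rows are replaced by zero. -/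
def plus {m n : ℕ} (W : Matrix (Fin m) (Fin n) ℝ) (r : E n) : Matrix (Fin m) (Fin n) ℝ :=
  Matrix.diagonal (fun i => if 0 < (W *ᵥ r.ofLp) i then (1 : ℝ) else 0) * W

/-- The unit vector `r / ‖r‖` (for `r ≠ 0`). -/
def unit {n : ℕ} (r : E n) : E n := ‖r‖⁻¹ • r

/-- The operator `M_{r̂ ↔ ŝ}` which exchanges the unit vectors `r̂ = r / ‖r‖` and `ŝ = s / ‖s‖`
and whose kernel is `span {r, s}ᗮ`: orthogonal projection onto `span {r, s}`, followed by the
reflection in the hyperplane orthogonal to `r̂ - ŝ` (the identity if `r̂ = ŝ`).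
The three defining properties are proved in `swap_unit_left`, `swap_unit_right`, `ker_swap`. -/
def swap {n : ℕ} (r s : E n) : E n →L[ℝ] E n :=
  ((ℝ ∙ (unit r - unit s))ᗮ.reflection : E n →L[ℝ] E n) ∘L
    (Submodule.span ℝ {r, s}).starProjection

/-- `Q_{r,s} = (π - θ)/(2π) I + (sin θ)/(2π) M_{r̂ ↔ ŝ}` with `θ = ∠(r, s)` if `r` and `s` are
both nonzero, and `Q_{r,s} = 0` otherwise. -/
def Q {n : ℕ} (r s : E n) : E n →L[ℝ] E n :=
  open Classical in
  if r = 0 ∨ s = 0 then 0 else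
    ((Real.pi - InnerProductGeometry.angle r s) / (2 * Real.pi)) • ContinuousLinearMap.id ℝ (E n) +
      (Real.sin (InnerProductGeometry.angle r s) / (2 * Real.pi)) • swap r s

/-- `|⟨W_{+,r}ᵀ W_{+,s} u, v⟩ - ⟨Q_{r,s} u, v⟩| ≤ ε ‖u‖ ‖v‖` for all
`u ∈ U`, `v ∈ V`, `r ∈ R`, `s ∈ S`. -/
def UniformBound {m n : ℕ} (W : Matrix (Fin m) (Fin n) ℝ) (ε : ℝ) (U V R S : Set (E n)) : Prop :=
  ∀ u ∈ U, ∀ v ∈ V, ∀ r ∈ R, ∀ s ∈ S,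
    |inner ℝ (Matrix.toEuclideanLin ((plus W r)ᵀ * plus W s) u) v - inner ℝ (Q r s u) v|
      ≤ ε * ‖u‖ * ‖v‖

/-- The entries of the random matrix `W` are independent `N(0, 1/m)` random variables. -/
structure IsGaussianMatrix {Ω : Type*} [MeasurableSpace Ω] (P : Measure Ω) {m n : ℕ}
    (W : Ω → Matrix (Fin m) (Fin n) ℝ) : Prop where
  hasLaw : ∀ i j, HasLaw (fun ω => W ω i j) (gaussianReal 0 ((m : NNReal)⁻¹)) P
  indep : iIndepFun (fun (p : Fin m × Fin n) (ω : Ω) => W ω p.1 p.2) P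

/-- The property `A` holds with `P`-probability exceeding `p`: it holds on a measurable event of
probability larger than `p`. For a measurable `A` this is `p < P A`; in general it is
the strict lower bound `p` on the inner probability of `A`. -/
def HoldsWithProbExceeding {Ω : Type*} [MeasurableSpace Ω] (P : Measure Ω) (A : Ω → Prop)
    (p : ℝ) : Prop :=
  ∃ F : Set Ω, MeasurableSet F ∧ (∀ ω ∈ F, A ω) ∧ p < P.real F

theorem norm_unit {n : ℕ} {r : E n} (hr : r ≠ 0) : ‖unit r‖ = 1 := by
  rw [unit, norm_smul, norm_inv, norm_norm, inv_mul_cancel₀ (norm_ne_zero_iff.mpr hr)]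

theorem swap_unit_left {n : ℕ} {r s : E n} (hr : r ≠ 0) (hs : s ≠ 0) :
    swap r s (unit r) = unit s := by
  have h : unit r ∈ Submodule.span ℝ {r, s} :=
    Submodule.smul_mem _ _ (Submodule.subset_span (by simp))
  simp only [swap, ContinuousLinearMap.comp_apply]
  rw [Submodule.starProjection_eq_self_iff.mpr h]
  exact Submodule.reflection_sub (by rw [norm_unit hr, norm_unit hs])

theorem swap_unit_right {n : ℕ} {r s : E n} (hr : r ≠ 0) (hs : s ≠ 0) :
    swap r s (unit s) = unit r := by
  have h : unit s ∈ Submodule.span ℝ {r, s} :=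
    Submodule.smul_mem _ _ (Submodule.subset_span (by simp))
  simp only [swap, ContinuousLinearMap.comp_apply]
  rw [Submodule.starProjection_eq_self_iff.mpr h]
  have h2 := Submodule.reflection_sub (v := unit r) (w := unit s)
    (by rw [norm_unit hr, norm_unit hs])
  change (ℝ ∙ (unit r - unit s))ᗮ.reflection (unit s) = unit r
  exact (congrArg _ h2.symm).trans (Submodule.reflection_reflection _ _)

theorem ker_swap {n : ℕ} (r s : E n) :
    LinearMap.ker (swap r s : E n →ₗ[ℝ] E n) = (Submodule.span ℝ {r, s})ᗮ := by
  ext x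
  rw [LinearMap.mem_ker, ← Submodule.starProjection_apply_eq_zero_iff]
  change (ℝ ∙ (unit r - unit s))ᗮ.reflection _ = 0 ↔ _
  exact LinearIsometryEquiv.map_eq_zero_iff _

end ReluConcentration

end

/-!
The theorem is proved by a net argument in which the masks, although discontinuous, are perturbed
in mean. Write `gᵢ` for the rows of `W` scaled by `√m`; they are independent standard Gaussian
vectors (`IsGaussianMatrix.hasLaw_row`, `IsGaussianMatrix.iIndepFun_row`) and
`⟨W_{+,r}ᵀ W_{+,s} u, v⟩` is the empirical mean of `1[⟨x, r⟩ > 0, ⟨x, s⟩ > 0] ⟨x, u⟩ ⟨x, v⟩` over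
them (`inner_plus_eq`).

* The expectation of this function for `u = v` is `⟨Q_{r,s} u, u⟩`
  (`integral_both_eq_inner_Q`): the component of `u` orthogonal to the plane of `r` and `s` is
  independent of the mask, and in the plane polar coordinates give the mean over a wedge of opening
  angle `π - θ`.
* For fixed `u`, `r`, `s` the empirical mean of a function dominated by the square of a Gaussian
  variable deviates from its expectation by `a` with probability at most
  `2 exp (-a² m / 512)` (`measure_le_abs_empMean_sub`).
* If the sign of `⟨x, r⟩` differs from that of `⟨x, r₀⟩`, then either `|⟨x, r₀⟩| ≤ δ`, or
  `|⟨x, r - r₀⟩| > δ`. So moving `r` to `r₀` changes the mean of the masked square `⟨x, u⟩²` by at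
  most its mean over a thin slab around the hyperplane of `r₀`, its tail above a level `t²`, and
  `(t / δ)²` times the mean of `⟨x, r - r₀⟩²` (`abs_integral_both_sub_le`). This holds for every
  measure with second moments, hence both for the empirical measure and for the Gaussian one. The bounding means are
  themselves means of functions attached to net points, except for the last one, which is a
  quadratic form in `r - r₀`.

Thus it suffices to control six empirical means at each triple of points of nets of the unit
spheres of `T`, `R`, `S` (`abs_empMean_sub_le_of_nets`). The mesh of the nets is a power of `ε`, so
their cardinality is at most `exp (K ε⁻³ ℓ')` and is absorbed by half of the exponent of the
concentration bound once `m ≥ C_ε ℓ'` (`measureReal_not_uniformBound_le`). In particular the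
failure probability for one choice of subspaces is at most `12 exp (-c_ε m)`, which is smaller than
the stated bound as `(e m / ℓ)^(2 ℓ) ≥ 1`. Bilinear forms are recovered from quadratic ones
by polarization, on `T = U_i + V_j` for unions of subspaces.
-/

noncomputable section

namespace ReluConcentration

section

/-! ### One-dimensional Gaussian estimates -/

theorem integrable_exp_sq_div_four :
    Integrable (fun z : ℝ => Real.exp (z ^ 2 / 4)) (gaussianReal 0 1) := by
  rw [gaussianReal_of_var_ne_zero _ one_ne_zero,
    integrable_withDensity_iff_integrable_smul' (measurable_gaussianPDF _ _)
      (ae_of_all _ fun _ => gaussianPDF_lt_top)]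
  have h := (integrable_exp_neg_mul_sq (b := 1 / 4) (by norm_num)).const_mul
    ((√(2 * Real.pi * 1))⁻¹)
  refine h.congr (ae_of_all _ fun z => ?_)
  simp only [toReal_gaussianPDF, gaussianPDFReal, smul_eq_mul, NNReal.coe_one, mul_one, sub_zero]
  rw [mul_assoc, ← Real.exp_add]
  ring_nf

theorem integral_exp_sq_div_four :
    ∫ z : ℝ, Real.exp (z ^ 2 / 4) ∂(gaussianReal 0 1) = √2 := by
  rw [integral_gaussianReal_eq_integral_smul one_ne_zero]
  have h : ∀ z : ℝ, gaussianPDFReal 0 1 z • Real.exp (z ^ 2 / 4) =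
      (√(2 * Real.pi))⁻¹ * Real.exp (-(1 / 4) * z ^ 2) := fun z => by
    simp only [gaussianPDFReal, smul_eq_mul, NNReal.coe_one, mul_one, sub_zero]
    rw [mul_assoc, ← Real.exp_add]
    ring_nf
  simp_rw [h]
  rw [integral_const_mul, integral_gaussian, ← Real.sqrt_inv, ← Real.sqrt_mul (by positivity)]
  congr 1
  field_simp
  norm_num

theorem gaussianReal_abs_le (δ : ℝ) (hδ : 0 ≤ δ) :
    (gaussianReal 0 1).real {z | |z| ≤ δ} ≤ δ := by
  have hs : {z : ℝ | |z| ≤ δ} = Set.Icc (-δ) δ := by ext; simp [abs_le]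
  have h1 : ∀ z, gaussianPDF 0 1 z ≤ ENNReal.ofReal (1 / 2) := fun z => by
    refine ENNReal.ofReal_le_ofReal ?_
    simp only [gaussianPDFReal, NNReal.coe_one, mul_one, sub_zero]
    have h2 : (2 : ℝ) ≤ √(2 * Real.pi) :=
      Real.le_sqrt_of_sq_le (by nlinarith [Real.pi_gt_three])
    have h3 : Real.exp (-z ^ 2 / 2) ≤ 1 := Real.exp_le_one_iff.mpr (by nlinarith [sq_nonneg z])
    have h4 : (√(2 * Real.pi))⁻¹ ≤ 1 / 2 := by
      rw [one_div]
      exact inv_anti₀ (by norm_num) h2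
    nlinarith [Real.exp_pos (-z ^ 2 / 2)]
  rw [Measure.real, gaussianReal_of_var_ne_zero _ one_ne_zero, hs,
    withDensity_apply _ measurableSet_Icc]
  refine ENNReal.toReal_le_of_le_ofReal hδ ?_
  calc ∫⁻ z in Set.Icc (-δ) δ, gaussianPDF 0 1 z
      ≤ ∫⁻ _ in Set.Icc (-δ) δ, ENNReal.ofReal (1 / 2) := lintegral_mono h1
    _ = ENNReal.ofReal δ := by
      rw [lintegral_const, Measure.restrict_apply_univ, Real.volume_Icc,
        ← ENNReal.ofReal_mul (by norm_num)]
      congr 1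
      ring

/-! ### Linear functionals of a standard Gaussian vector -/

variable {n : ℕ}

theorem map_inner_stdGaussian {y : E n} (hy : ‖y‖ = 1) :
    (stdGaussian (E n)).map (fun x => inner ℝ x y) = gaussianReal 0 1 := by
  have h := IsGaussian.map_eq_gaussianReal (μ := stdGaussian (E n)) (innerSL ℝ y)
  rw [integral_strongDual_stdGaussian, variance_dual_stdGaussian, innerSL_apply_norm, hy] at h
  simp only [one_pow, Real.toNNReal_one] at h
  rw [← h]
  congr 1
  ext x
  simp [real_inner_comm]

theorem integrable_comp_inner {y : E n} (hy : ‖y‖ = 1) {f : ℝ → ℝ}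
    (hf : Integrable f (gaussianReal 0 1)) :
    Integrable (fun x : E n => f (inner ℝ x y)) (stdGaussian (E n)) := by
  rw [← map_inner_stdGaussian hy] at hf
  exact hf.comp_measurable (by fun_prop)

theorem integral_comp_inner {y : E n} (hy : ‖y‖ = 1) {f : ℝ → ℝ} (hf : Measurable f) :
    ∫ x : E n, f (inner ℝ x y) ∂(stdGaussian (E n)) = ∫ z, f z ∂(gaussianReal 0 1) := by
  rw [← map_inner_stdGaussian hy, integral_map (by fun_prop) hf.aestronglyMeasurable]

theorem integrable_sq_inner (y : E n) :
    Integrable (fun x : E n => (inner ℝ x y) ^ 2) (stdGaussian (E n)) := by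
  have : MemLp (fun x : E n => innerSL ℝ y x) 2 (stdGaussian (E n)) :=
    IsGaussian.memLp_dual (stdGaussian (E n)) _ 2 (by simp)
  simpa [real_inner_comm] using this.integrable_sq

theorem integral_sq_inner (y : E n) :
    ∫ x : E n, (inner ℝ x y) ^ 2 ∂(stdGaussian (E n)) = ‖y‖ ^ 2 := by
  have h := variance_dual_stdGaussian (E := E n) (innerSL ℝ y)
  rw [innerSL_apply_norm, variance_of_integral_eq_zero (by fun_prop)
    (integral_strongDual_stdGaussian _)] at h
  rw [← h]
  congr 1
  ext x
  simp [real_inner_comm]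

theorem pow_four_le_exp (z : ℝ) : z ^ 4 ≤ 32 * Real.exp (z ^ 2 / 4) := by
  have h := Real.quadratic_le_exp_of_nonneg (x := z ^ 2 / 4) (by positivity)
  nlinarith [sq_nonneg z]

/-- The part of the second moment `E ⟨x, u⟩²` carried by `{|⟨x, u⟩| > t}`. -/
def tail (t : ℝ) (u x : E n) : ℝ := if t < |inner ℝ x u| then (inner ℝ x u) ^ 2 else 0

theorem integral_tail_le {u : E n} (hu : ‖u‖ = 1) {t : ℝ} (ht : 0 < t) :
    ∫ x, tail t u x ∂(stdGaussian (E n)) ≤ 48 / t ^ 2 := by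
  have h1 : ∀ x : E n, tail t u x ≤ 32 / t ^ 2 * Real.exp ((inner ℝ x u) ^ 2 / 4) := fun x => by
    rw [div_mul_eq_mul_div, le_div_iff₀ (by positivity)]
    refine le_trans ?_ (pow_four_le_exp _)
    unfold tail
    split_ifs with h
    · have : t ^ 2 ≤ (inner ℝ x u) ^ 2 := by
        rw [← sq_abs (inner ℝ x u)]; exact pow_le_pow_left₀ ht.le h.le 2
      nlinarith [sq_nonneg (inner ℝ x u)]
    · rw [zero_mul]; positivity
  have h2 : ∀ x : E n, 0 ≤ tail t u x := fun x => by unfold tail; split_ifs <;> positivity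
  calc ∫ x, tail t u x ∂(stdGaussian (E n))
      ≤ ∫ x : E n, 32 / t ^ 2 * Real.exp ((inner ℝ x u) ^ 2 / 4) ∂(stdGaussian (E n)) :=
        integral_mono_of_nonneg (ae_of_all _ h2)
          ((integrable_comp_inner hu integrable_exp_sq_div_four).const_mul _) (ae_of_all _ h1)
    _ = 32 / t ^ 2 * √2 := by
      rw [integral_const_mul, integral_comp_inner hu (f := fun z => Real.exp (z ^ 2 / 4))
        (by fun_prop), integral_exp_sq_div_four]
    _ ≤ 48 / t ^ 2 := by
      rw [div_mul_eq_mul_div]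
      gcongr
      have : √2 ≤ 3 / 2 := Real.sqrt_le_iff.mpr (by norm_num)
      linarith

theorem stdGaussian_abs_inner_le {r : E n} (hr : ‖r‖ = 1) {δ : ℝ} (hδ : 0 ≤ δ) :
    (stdGaussian (E n)).real {x | |inner ℝ x r| ≤ δ} ≤ δ := by
  refine le_trans (le_of_eq ?_) (gaussianReal_abs_le δ hδ)
  rw [← map_inner_stdGaussian hr, map_measureReal_apply (by fun_prop)
    (measurableSet_le (by fun_prop) (by fun_prop))]
  rfl

end

section

variable {n : ℕ}

/-! ### A Chernoff bound for functions dominated by a squared Gaussian -/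

/-- A second-order bound on the exponential in which the quadratic remainder is absorbed into
an exponential with a fixed rate. -/
theorem exp_mul_le {l y : ℝ} (hl : |l| ≤ 1 / 8) :
    Real.exp (l * y) ≤ 1 + l * y + 64 * l ^ 2 * Real.exp (|y| / 4) := by
  have h1 : Real.exp (l * y) ≤ 1 + l * y + (l * y) ^ 2 * Real.exp |l * y| := by
    have h := Complex.norm_exp_sub_sum_le_norm_mul_exp ((l * y : ℝ) : ℂ) 2
    rw [show Complex.exp ((l * y : ℝ) : ℂ) -
        ∑ k ∈ Finset.range 2, ((l * y : ℝ) : ℂ) ^ k / (Nat.factorial k : ℕ) =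
        ((Real.exp (l * y) - (1 + l * y) : ℝ) : ℂ) by
      simp [Finset.sum_range_succ], Complex.norm_real, Complex.norm_real, Real.norm_eq_abs,
      Real.norm_eq_abs, sq_abs] at h
    linarith [le_abs_self (Real.exp (l * y) - (1 + l * y))]
  have h2 : Real.exp |l * y| ≤ Real.exp (|y| / 8) := by
    rw [Real.exp_le_exp, abs_mul]
    nlinarith [abs_nonneg y]
  have h3 : (|y| / 8) ^ 2 ≤ Real.exp (|y| / 8) := by
    have h := Real.quadratic_le_exp_of_nonneg (x := |y| / 16) (by positivity)
    have h' : |y| / 8 ≤ Real.exp (|y| / 16) := by nlinarith [sq_nonneg (|y| / 16 - 1)]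
    rw [show |y| / 8 = |y| / 16 + |y| / 16 by ring, Real.exp_add,
      show |y| / 16 + |y| / 16 = |y| / 8 by ring, sq]
    gcongr
  have h4 : Real.exp (|y| / 4) = Real.exp (|y| / 8) * Real.exp (|y| / 8) := by
    rw [← Real.exp_add]; ring_nf
  have h5 : (l * y) ^ 2 ≤ 64 * l ^ 2 * Real.exp (|y| / 8) := by
    have : (l * y) ^ 2 = 64 * l ^ 2 * (|y| / 8) ^ 2 := by
      rw [div_pow, sq_abs]; ring
    rw [this]
    gcongr
  calc _ ≤ _ := h1
    _ ≤ 1 + l * y + (64 * l ^ 2 * Real.exp (|y| / 8)) * Real.exp (|y| / 8) := by gcongr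
    _ = _ := by rw [h4]; ring

/-- The moment generating function of a centred function dominated by a squared Gaussian is
bounded near the origin by that of a Gaussian variable. -/
theorem integral_exp_centered_le {f : E n → ℝ} (hf : Measurable f) {y : E n} (hy : ‖y‖ = 1)
    (hfy : ∀ x, |f x| ≤ (inner ℝ x y) ^ 2) {l : ℝ} (hl : |l| ≤ 1 / 8) :
    Integrable (fun x => Real.exp (l * (f x - ∫ z, f z ∂(stdGaussian (E n)))))
      (stdGaussian (E n)) ∧
    ∫ x, Real.exp (l * (f x - ∫ z, f z ∂(stdGaussian (E n)))) ∂(stdGaussian (E n))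
      ≤ Real.exp (128 * l ^ 2) := by
  set ν := stdGaussian (E n)
  set μ := ∫ z, f z ∂ν
  have hfi : Integrable f ν := (integrable_sq_inner y).mono' hf.aestronglyMeasurable
    (ae_of_all _ hfy)
  have hμ : |μ| ≤ 1 := by
    calc |μ| ≤ ∫ x, |f x| ∂ν := abs_integral_le_integral_abs
      _ ≤ ∫ x : E n, (inner ℝ x y) ^ 2 ∂ν := integral_mono hfi.abs (integrable_sq_inner y) hfy
      _ = 1 := by rw [integral_sq_inner, hy, one_pow]
  have hb : ∀ x, Real.exp (|f x - μ| / 4) ≤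
      Real.exp (1 / 4) * Real.exp ((inner ℝ x y) ^ 2 / 4) := fun x => by
    rw [← Real.exp_add, Real.exp_le_exp]
    have := abs_sub (f x) μ
    have := hfy x
    linarith
  have hbi : Integrable (fun x : E n => Real.exp (1 / 4) * Real.exp ((inner ℝ x y) ^ 2 / 4)) ν :=
    (integrable_comp_inner hy integrable_exp_sq_div_four).const_mul _
  have hbe : ∫ x : E n, Real.exp (1 / 4) * Real.exp ((inner ℝ x y) ^ 2 / 4) ∂ν ≤ 2 := by
    rw [integral_const_mul, integral_comp_inner hy (f := fun z => Real.exp (z ^ 2 / 4))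
        (by fun_prop), integral_exp_sq_div_four]
    have h1 : √2 ≤ 142 / 100 := Real.sqrt_le_iff.mpr (by norm_num)
    have h2 : Real.exp (1 / 4) ≤ 4 / 3 := by
      have := Real.add_one_le_exp (-(1 / 4) : ℝ)
      have h3 : Real.exp (1 / 4) * Real.exp (-(1 / 4)) = 1 := by
        rw [← Real.exp_add]; norm_num
      nlinarith [Real.exp_pos (1 / 4)]
    nlinarith [Real.exp_pos (1 / 4), Real.sqrt_nonneg 2]
  have hp : ∀ x, Real.exp (l * (f x - μ)) ≤ 1 + l * (f x - μ) + 64 * l ^ 2 *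
      (Real.exp (1 / 4) * Real.exp ((inner ℝ x y) ^ 2 / 4)) := fun x =>
    (exp_mul_le hl).trans (by gcongr; exact hb x)
  have hri : Integrable (fun x => 1 + l * (f x - μ) + 64 * l ^ 2 *
      (Real.exp (1 / 4) * Real.exp ((inner ℝ x y) ^ 2 / 4))) ν :=
    ((integrable_const _).add ((hfi.sub (integrable_const _)).const_mul l)).add
      (hbi.const_mul _)
  have hei : Integrable (fun x => Real.exp (l * (f x - μ))) ν :=
    hri.mono' (by fun_prop) (ae_of_all _ fun x => by
      rw [Real.norm_eq_abs, abs_of_pos (Real.exp_pos _)]; exact hp x)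
  refine ⟨hei, (integral_mono hei hri hp).trans ?_⟩
  have hc : Integrable (fun x => l * (f x - μ)) ν := (hfi.sub (integrable_const _)).const_mul l
  have hc1 : Integrable (fun x => 1 + l * (f x - μ)) ν := (integrable_const _).add hc
  have hz : ∫ x, f x - μ ∂ν = 0 := by
    rw [integral_sub hfi (integrable_const _)]
    simp [μ]
  rw [integral_add hc1 (hbi.const_mul _), integral_add (integrable_const _) hc,
    integral_const_mul, integral_const_mul, hz]
  simp only [integral_const, probReal_univ, smul_eq_mul, mul_one]
  have := Real.add_one_le_exp (128 * l ^ 2)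
  nlinarith [sq_nonneg l]

/-- The empirical mean of `f` over the sample `g`. -/
def empMean {m : ℕ} (g : Fin m → E n) (f : E n → ℝ) : ℝ := (m : ℝ)⁻¹ * ∑ i, f (g i)

variable {Ω : Type*} [MeasurableSpace Ω] {P : Measure Ω} [IsProbabilityMeasure P]

/-- Chernoff bound for the upper deviation, with the exponential parameter `a / 256`. -/
theorem measure_le_empMean {m : ℕ} (hm : 0 < m) {g : Fin m → Ω → E n}
    (hg : ∀ i, HasLaw (g i) (stdGaussian (E n)) P) (hind : iIndepFun g P)
    {f : E n → ℝ} (hf : Measurable f) {y : E n} (hy : ‖y‖ = 1)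
    (hfy : ∀ x, |f x| ≤ (inner ℝ x y) ^ 2) {a : ℝ} (ha : 0 < a) (ha1 : a ≤ 1) :
    P.real {ω | a ≤ empMean (fun i => g i ω) f - ∫ x, f x ∂(stdGaussian (E n))}
      ≤ Real.exp (-(a ^ 2 / 512 * m)) := by
  set μ := ∫ x, f x ∂(stdGaussian (E n))
  have hm' : (0 : ℝ) < m := Nat.cast_pos.mpr hm
  set l : ℝ := a / 256
  have hl : |l| ≤ 1 / 8 := by
    rw [abs_of_pos (by positivity)]; simp only [l]; linarith
  obtain ⟨hi, hle⟩ := integral_exp_centered_le hf hy hfy hl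
  set X : Fin m → Ω → ℝ := fun i ω => f (g i ω) - μ
  have hXm : ∀ i, AEMeasurable (X i) P := fun i =>
    (hf.comp_aemeasurable (hg i).aemeasurable).sub_const _
  have hX : iIndepFun X P := hind.comp (fun _ x => f x - μ) (fun _ => hf.sub_const _)
  have hXi : ∀ i, Integrable (fun ω => Real.exp (l * X i ω)) P := fun i => by
    have hi' : Integrable (fun x => Real.exp (l * (f x - μ))) (P.map (g i)) := by
      rw [(hg i).map_eq]; exact hi
    exact hi'.comp_aemeasurable (hg i).aemeasurable
  have hXe : ∀ i, mgf (X i) P l ≤ Real.exp (128 * l ^ 2) := fun i => by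
    refine le_trans (le_of_eq ?_) hle
    exact (hg i).integral_comp (f := fun x => Real.exp (l * (f x - μ))) (by fun_prop)
  have hset : {ω | a ≤ empMean (fun i => g i ω) f - μ} =
      {ω | a * m ≤ (∑ i, X i) ω} := by
    ext ω
    simp only [Set.mem_ofPred_eq, empMean, X, Finset.sum_apply, Finset.sum_sub_distrib,
      Finset.sum_const, Finset.card_univ, Fintype.card_fin, nsmul_eq_mul]
    rw [← mul_le_mul_iff_left₀ hm', sub_mul, mul_comm (m : ℝ)⁻¹, mul_assoc,
      inv_mul_cancel₀ hm'.ne', mul_one, mul_comm μ]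
  rw [hset]
  have hint : Integrable (fun ω => Real.exp (l * (∑ i, X i) ω)) P := by
    -- a Bochner integral that is not zero is the integral of an integrable function
    refine not_imp_comm.1 integral_undef (ne_of_gt ?_)
    change 0 < mgf (∑ i, X i) P l
    rw [hX.mgf_sum₀ hXm]
    exact Finset.prod_pos fun i _ => mgf_pos (hXi i)
  refine (measure_ge_le_exp_mul_mgf (a * m) (t := l) (by positivity) hint).trans ?_
  rw [hX.mgf_sum₀ hXm]
  calc Real.exp (-l * (a * m)) * ∏ i, mgf (X i) P l
      ≤ Real.exp (-l * (a * m)) * ∏ _i : Fin m, Real.exp (128 * l ^ 2) := by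
        gcongr with i
        · exact fun _ _ => mgf_nonneg
        · exact hXe i
    _ = Real.exp (-(a ^ 2 / 512 * m)) := by
      rw [Finset.prod_const, Finset.card_univ, Fintype.card_fin, ← Real.exp_nat_mul,
        ← Real.exp_add]
      congr 1
      simp only [l]
      ring

/-- Two-sided version of `measure_le_empMean`. -/
theorem measure_le_abs_empMean_sub {m : ℕ} (hm : 0 < m) {g : Fin m → Ω → E n}
    (hg : ∀ i, HasLaw (g i) (stdGaussian (E n)) P) (hind : iIndepFun g P)
    {f : E n → ℝ} (hf : Measurable f) {y : E n} (hy : ‖y‖ = 1)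
    (hfy : ∀ x, |f x| ≤ (inner ℝ x y) ^ 2) {a : ℝ} (ha : 0 < a) (ha1 : a ≤ 1) :
    P.real {ω | a ≤ |empMean (fun i => g i ω) f - ∫ x, f x ∂(stdGaussian (E n))|}
      ≤ 2 * Real.exp (-(a ^ 2 / 512 * m)) := by
  have h1 := measure_le_empMean hm hg hind hf hy hfy ha ha1
  have h2 := measure_le_empMean hm hg hind hf.neg hy (fun x => by simpa using hfy x) ha ha1
  have hs : {ω | a ≤ |empMean (fun i => g i ω) f - ∫ x, f x ∂(stdGaussian (E n))|} ⊆
      {ω | a ≤ empMean (fun i => g i ω) f - ∫ x, f x ∂(stdGaussian (E n))} ∪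
      {ω | a ≤ empMean (fun i => g i ω) (-f) - ∫ x, (-f) x ∂(stdGaussian (E n))} := by
    intro ω hω
    simp only [Set.mem_union, Set.mem_ofPred_eq, Pi.neg_apply, integral_neg, empMean,
      Finset.sum_neg_distrib] at hω ⊢
    rcases le_abs.mp hω with h | h
    · exact Or.inl h
    · right; linarith
  refine (measureReal_mono hs).trans ((measureReal_union_le _ _).trans ?_)
  rw [two_mul]
  exact add_le_add h1 h2

end

section

variable {n : ℕ}

/-! ### Gaussian integrals over a wedge -/

/-- Polar coordinates: the Gaussian integral of a positively `k`-homogeneous function of the plane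
is a radial moment times the integral over the circle. -/
theorem integral_gaussian_prod_of_homogeneous {F : ℝ × ℝ → ℝ} {H : ℝ → ℝ} (k : ℕ)
    (hF : ∀ ρ φ : ℝ, 0 < ρ → F (ρ * Real.cos φ, ρ * Real.sin φ) = ρ ^ k * H φ) :
    ∫ p, F p ∂((gaussianReal 0 1).prod (gaussianReal 0 1)) =
      (2 * Real.pi)⁻¹ * (∫ ρ in Set.Ioi (0 : ℝ), ρ ^ (k + 1) * Real.exp (-ρ ^ 2 / 2)) *
        ∫ φ in Set.Ioo (-Real.pi) Real.pi, H φ := by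
  have h0 : (2 * Real.pi)⁻¹ = (√(2 * Real.pi))⁻¹ * (√(2 * Real.pi))⁻¹ := by
    rw [← mul_inv, Real.mul_self_sqrt (by positivity)]
  rw [gaussianReal_of_var_ne_zero _ one_ne_zero,
    prod_withDensity (measurable_gaussianPDF _ _) (measurable_gaussianPDF _ _),
    integral_withDensity_eq_integral_toReal_smul (by fun_prop)
      (ae_of_all _ fun _ => ENNReal.mul_lt_top gaussianPDF_lt_top gaussianPDF_lt_top),
    ← Measure.volume_eq_prod, ← integral_comp_polarCoord_symm, polarCoord_target]
  rw [mul_assoc, Measure.volume_eq_prod, ← setIntegral_prod_mul, ← integral_const_mul]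
  refine setIntegral_congr_fun (measurableSet_Ioi.prod measurableSet_Ioo) fun p hp => ?_
  have hρ : 0 < p.1 := hp.1
  simp only [polarCoord_symm_apply, smul_eq_mul, hF _ _ hρ, ENNReal.toReal_mul,
    toReal_gaussianPDF, gaussianPDFReal, NNReal.coe_one, mul_one, sub_zero]
  have h1 : Real.exp (-p.1 ^ 2 / 2) = Real.exp (-(p.1 * Real.cos p.2) ^ 2 / 2) *
      Real.exp (-(p.1 * Real.sin p.2) ^ 2 / 2) := by
    rw [← Real.exp_add]
    congr 1
    linear_combination (p.1 ^ 2 / 2) * Real.sin_sq_add_cos_sq p.2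
  rw [h1, h0]
  ring

theorem integral_rexp_radial_one :
    ∫ ρ in Set.Ioi (0 : ℝ), ρ ^ (0 + 1) * Real.exp (-ρ ^ 2 / 2) = 1 := by
  have h := integral_rpow_mul_exp_neg_mul_rpow (p := 2) (q := 1) (b := 1 / 2) (by norm_num)
    (by norm_num) (by norm_num)
  norm_num [Real.rpow_neg_one] at h
  rw [← h]
  congr 1
  ext ρ
  rw [zero_add, pow_one]
  congr 2
  ring

theorem integral_rexp_radial_three :
    ∫ ρ in Set.Ioi (0 : ℝ), ρ ^ (2 + 1) * Real.exp (-ρ ^ 2 / 2) = 2 := by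
  have h := integral_rpow_mul_exp_neg_mul_rpow (p := 2) (q := 3) (b := 1 / 2) (by norm_num)
    (by norm_num) (by norm_num)
  have h1 : ((1 : ℝ) / 2) ^ (-(3 + 1) / 2 : ℝ) * (1 / 2) * Real.Gamma ((3 + 1) / 2) = 2 := by
    rw [show (-(3 + 1) / 2 : ℝ) = -(2 : ℕ) by norm_num, Real.rpow_neg (by norm_num),
      Real.rpow_natCast, show ((3 + 1) / 2 : ℝ) = 2 by norm_num, Real.Gamma_two]
    norm_num
  refine Eq.trans ?_ (h.trans h1)
  refine setIntegral_congr_fun measurableSet_Ioi fun ρ _ => ?_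
  have h3 : ρ ^ (3 : ℝ) = ρ ^ 3 := by exact_mod_cast Real.rpow_natCast ρ 3
  have h2 : ρ ^ (2 : ℝ) = ρ ^ 2 := by exact_mod_cast Real.rpow_natCast ρ 2
  simp only [h3, h2]
  congr 2
  ring

/-- The indicator function of the wedge of points of the plane which have positive inner product
with `(1, 0)` and `(cos θ, sin θ)`. -/
def wedge (θ : ℝ) (p : ℝ × ℝ) : ℝ :=
  if 0 < p.1 ∧ 0 < Real.cos θ * p.1 + Real.sin θ * p.2 then 1 else 0

theorem measurable_wedge (θ : ℝ) : Measurable (wedge θ) := by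
  have h1 : MeasurableSet {p : ℝ × ℝ | 0 < p.1} := measurableSet_lt (by fun_prop) (by fun_prop)
  have h2 : MeasurableSet {p : ℝ × ℝ | 0 < Real.cos θ * p.1 + Real.sin θ * p.2} :=
    measurableSet_lt (by fun_prop) (by fun_prop)
  exact Measurable.ite (h1.inter h2) measurable_const measurable_const

theorem wedge_mul (θ : ℝ) {ρ : ℝ} (hρ : 0 < ρ) (x y : ℝ) :
    wedge θ (ρ * x, ρ * y) = wedge θ (x, y) := by
  unfold wedge
  have h1 : 0 < ρ * x ↔ 0 < x := mul_pos_iff_of_pos_left hρ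
  have h2 : 0 < Real.cos θ * (ρ * x) + Real.sin θ * (ρ * y) ↔
      0 < Real.cos θ * x + Real.sin θ * y := by
    rw [show Real.cos θ * (ρ * x) + Real.sin θ * (ρ * y) =
      ρ * (Real.cos θ * x + Real.sin θ * y) by ring]
    exact mul_pos_iff_of_pos_left hρ
  simp only [h1, h2]

theorem setIntegral_wedge {θ : ℝ} (h0 : 0 ≤ θ) (hpi : θ ≤ Real.pi) (h : ℝ → ℝ) :
    ∫ φ in Set.Ioo (-Real.pi) Real.pi, wedge θ (Real.cos φ, Real.sin φ) * h φ =
      ∫ φ in (θ - Real.pi / 2)..(Real.pi / 2), h φ := by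
  have hp := Real.pi_pos
  have hind : ∀ φ ∈ Set.Ioo (-Real.pi) Real.pi, wedge θ (Real.cos φ, Real.sin φ) * h φ =
      (Set.Ioo (θ - Real.pi / 2) (Real.pi / 2)).indicator h φ := by
    intro φ hφ
    have hiff : (0 < Real.cos φ ∧ 0 < Real.cos θ * Real.cos φ + Real.sin θ * Real.sin φ) ↔
        φ ∈ Set.Ioo (θ - Real.pi / 2) (Real.pi / 2) := by
      rw [mul_comm (Real.cos θ), mul_comm (Real.sin θ), ← Real.cos_sub]
      constructor
      · rintro ⟨h1, h2⟩
        have h3 : φ < Real.pi / 2 := by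
          by_contra hc
          exact absurd h1 (not_lt.mpr (Real.cos_nonpos_of_pi_div_two_le_of_le (not_lt.mp hc)
            (by linarith [hφ.2])))
        refine ⟨?_, h3⟩
        by_contra hc
        have := Real.cos_nonpos_of_pi_div_two_le_of_le (x := θ - φ)
          (by linarith [not_lt.mp hc]) ?_
        · rw [← Real.cos_neg, neg_sub] at this; linarith
        · have h4 : -(Real.pi / 2) < φ := by
            by_contra hc'
            have := Real.cos_nonpos_of_pi_div_two_le_of_le (x := -φ)
              (by linarith [not_lt.mp hc']) (by linarith [hφ.1])
            rw [Real.cos_neg] at this; linarith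
          linarith
      · rintro ⟨h1, h2⟩
        exact ⟨Real.cos_pos_of_mem_Ioo ⟨by linarith, h2⟩,
          Real.cos_pos_of_mem_Ioo ⟨by linarith, by linarith⟩⟩
    by_cases hm : φ ∈ Set.Ioo (θ - Real.pi / 2) (Real.pi / 2)
    · rw [Set.indicator_of_mem hm, wedge, if_pos (hiff.mpr hm), one_mul]
    · rw [Set.indicator_of_notMem hm, wedge, if_neg (fun h => hm (hiff.mp h)), zero_mul]
  rw [setIntegral_congr_fun measurableSet_Ioo hind, setIntegral_indicator measurableSet_Ioo,
    Set.inter_eq_right.mpr (Set.Ioo_subset_Ioo (by linarith) (by linarith)),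
    intervalIntegral.integral_of_le (by linarith), integral_Ioc_eq_integral_Ioo]

theorem integral_wedge {θ : ℝ} (h0 : 0 ≤ θ) (hpi : θ ≤ Real.pi) :
    ∫ p, wedge θ p ∂((gaussianReal 0 1).prod (gaussianReal 0 1)) =
      (Real.pi - θ) / (2 * Real.pi) := by
  rw [integral_gaussian_prod_of_homogeneous 0
      (H := fun φ => wedge θ (Real.cos φ, Real.sin φ) * 1)
      (fun ρ φ hρ => by rw [wedge_mul θ hρ, pow_zero, one_mul, mul_one]),
    integral_rexp_radial_one, setIntegral_wedge h0 hpi]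
  simp only [intervalIntegral.integral_const, smul_eq_mul]
  ring

theorem integral_wedge_mul_sq {θ : ℝ} (h0 : 0 ≤ θ) (hpi : θ ≤ Real.pi) (a b : ℝ) :
    ∫ p, wedge θ p * (a * p.1 + b * p.2) ^ 2 ∂((gaussianReal 0 1).prod (gaussianReal 0 1)) =
      (Real.pi - θ) / (2 * Real.pi) * (a ^ 2 + b ^ 2) + Real.sin θ / (2 * Real.pi) *
        ((a ^ 2 - b ^ 2) * Real.cos θ + 2 * a * b * Real.sin θ) := by
  rw [integral_gaussian_prod_of_homogeneous 2
      (H := fun φ => wedge θ (Real.cos φ, Real.sin φ) * (a * Real.cos φ + b * Real.sin φ) ^ 2)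
      (fun ρ φ hρ => by rw [wedge_mul θ hρ]; ring),
    integral_rexp_radial_three, setIntegral_wedge h0 hpi]
  have hd : ∀ φ ∈ Set.uIcc (θ - Real.pi / 2) (Real.pi / 2),
      HasDerivAt (fun φ => a ^ 2 * ((φ + Real.sin φ * Real.cos φ) / 2) +
        b ^ 2 * ((φ - Real.sin φ * Real.cos φ) / 2) + a * b * Real.sin φ ^ 2)
        ((a * Real.cos φ + b * Real.sin φ) ^ 2) φ := by
    intro φ _
    have hsc : HasDerivAt (fun φ => Real.sin φ * Real.cos φ)
        (Real.cos φ * Real.cos φ + Real.sin φ * -Real.sin φ) φ :=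
      (Real.hasDerivAt_sin φ).mul (Real.hasDerivAt_cos φ)
    have := (((((hasDerivAt_id' φ).add hsc).div_const 2).const_mul (a ^ 2)).add
      ((((hasDerivAt_id' φ).sub hsc).div_const 2).const_mul (b ^ 2))).add
      (((Real.hasDerivAt_sin φ).pow 2).const_mul (a * b))
    convert! this using 1
    have h1 := Real.sin_sq_add_cos_sq φ
    push_cast
    linear_combination (a ^ 2 / 2 + b ^ 2 / 2) * h1
  rw [intervalIntegral.integral_eq_sub_of_hasDerivAt hd
    (Continuous.intervalIntegrable (by fun_prop) _ _), Real.sin_sub_pi_div_two,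
    Real.cos_sub_pi_div_two, Real.sin_pi_div_two, Real.cos_pi_div_two]
  have h1 := Real.sin_sq_add_cos_sq θ
  field_simp
  linear_combination (-4 * a * b) * h1

end

section

variable {n : ℕ}

/-! ### The expectation of a masked quadratic form -/

/-- The indicator function of `{x | 0 < ⟨x, r⟩, 0 < ⟨x, s⟩}`. -/
def both (r s x : E n) : ℝ := if 0 < inner ℝ x r ∧ 0 < inner ℝ x s then 1 else 0

theorem both_nonneg (r s x : E n) : 0 ≤ both r s x := by unfold both; split_ifs <;> simp

theorem both_le_one (r s x : E n) : both r s x ≤ 1 := by unfold both; split_ifs <;> simp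

theorem measurable_both (r s : E n) : Measurable (both r s) := by
  have h : ∀ y : E n, MeasurableSet {x : E n | 0 < inner ℝ x y} := fun y =>
    measurableSet_lt (by fun_prop) (by fun_prop)
  exact Measurable.ite ((h r).inter (h s)) measurable_const measurable_const

theorem both_smul {a b : ℝ} (ha : 0 < a) (hb : 0 < b) (r s x : E n) :
    both (a • r) (b • s) x = both r s x := by
  simp only [both, real_inner_smul_right, mul_pos_iff_of_pos_left ha, mul_pos_iff_of_pos_left hb]

/-- The coordinates of a standard Gaussian vector along orthogonal directions are independent, since
they are jointly Gaussian and uncorrelated. -/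
theorem iIndepFun_inner_of_orthogonal {k : ℕ} {v : Fin k → E n}
    (hv : ∀ i j, i ≠ j → inner ℝ (v i) (v j) = 0) :
    iIndepFun (fun i (x : E n) => inner ℝ x (v i)) (stdGaussian (E n)) := by
  have hG : HasGaussianLaw (fun (x : E n) i => inner ℝ x (v i)) (stdGaussian (E n)) := by
    have := (IsGaussian.hasGaussianLaw_id (μ := stdGaussian (E n))).map_fun
      (ContinuousLinearMap.pi fun i => innerSL ℝ (v i))
    refine this.congr (ae_of_all _ fun x => ?_)
    ext i
    simp [real_inner_comm]
  refine hG.iIndepFun_of_covariance_eq_zero fun i j hij => ?_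
  have h := covarianceBilin_apply_eq_cov (μ := stdGaussian (E n)) IsGaussian.memLp_two_id
    (v i) (v j)
  rw [covarianceBilin_stdGaussian, innerSL_apply_apply, hv i j hij] at h
  simp_rw [real_inner_comm] at h ⊢
  exact h.symm

theorem integral_both_mul_sq {f₁ f₂ w : E n} (h₁ : ‖f₁‖ = 1) (h₂ : ‖f₂‖ = 1)
    (h₁₂ : inner ℝ f₁ f₂ = 0) (hw₁ : inner ℝ f₁ w = 0) (hw₂ : inner ℝ f₂ w = 0)
    {θ : ℝ} (h0 : 0 ≤ θ) (hpi : θ ≤ Real.pi) (a b : ℝ) :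
    ∫ x, both f₁ (Real.cos θ • f₁ + Real.sin θ • f₂) x *
        (inner ℝ x (a • f₁ + b • f₂ + w)) ^ 2 ∂(stdGaussian (E n)) =
      (Real.pi - θ) / (2 * Real.pi) * (a ^ 2 + b ^ 2 + ‖w‖ ^ 2) + Real.sin θ / (2 * Real.pi) *
        ((a ^ 2 - b ^ 2) * Real.cos θ + 2 * a * b * Real.sin θ) := by
  set ν := stdGaussian (E n)
  have hI : iIndepFun (fun i (x : E n) => inner ℝ x (![f₁, f₂, w] i)) ν := by
    refine iIndepFun_inner_of_orthogonal fun i j hij => ?_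
    fin_cases i <;> fin_cases j <;>
      simp_all [real_inner_comm]
  set p : E n → ℝ × ℝ := fun x => (inner ℝ x f₁, inner ℝ x f₂)
  set Z : E n → ℝ := fun x => inner ℝ x w
  have hpm : Measurable p := by fun_prop
  have hpZ : IndepFun p Z ν :=
    hI.indepFun_prodMk (fun i => by fun_prop) 0 1 2 (by decide) (by decide)
  have hp : ν.map p = (gaussianReal 0 1).prod (gaussianReal 0 1) := by
    have h := hI.indepFun (i := 0) (j := 1) (by decide)
    have := (indepFun_iff_map_prod_eq_prod_map_map (by fun_prop) (by fun_prop)).mp h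
    refine this.trans ?_
    simp only [Matrix.cons_val_zero, Matrix.cons_val_one]
    rw [map_inner_stdGaussian h₁, map_inner_stdGaussian h₂]
  have hpi' : ∀ G : ℝ × ℝ → ℝ, Measurable G →
      ∫ x, G (p x) ∂ν = ∫ q, G q ∂((gaussianReal 0 1).prod (gaussianReal 0 1)) := fun G hG => by
    rw [← hp, integral_map hpm.aemeasurable hG.aestronglyMeasurable]
  -- the integrand splits into a planar part, a cross term and a part orthogonal to the plane
  have hsplit : ∀ x, both f₁ (Real.cos θ • f₁ + Real.sin θ • f₂) x *
      (inner ℝ x (a • f₁ + b • f₂ + w)) ^ 2 =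
      wedge θ (p x) * (a * (p x).1 + b * (p x).2) ^ 2 +
        (wedge θ (p x) * (2 * (a * (p x).1 + b * (p x).2)) * Z x + wedge θ (p x) * Z x ^ 2) := by
    intro x
    have hb : both f₁ (Real.cos θ • f₁ + Real.sin θ • f₂) x = wedge θ (p x) := by
      simp only [both, wedge, p, inner_add_right, real_inner_smul_right]
    rw [hb]
    simp only [p, Z, inner_add_right, real_inner_smul_right]
    ring
  have hm := measurable_wedge θ
  have hw01 : ∀ q, |wedge θ q| ≤ 1 := fun q => by unfold wedge; split_ifs <;> simp
  have hbdd : ∀ {h : E n → ℝ}, Integrable h ν → Integrable (fun x => wedge θ (p x) * h x) ν :=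
    fun hh => hh.bdd_mul (c := 1) (hm.comp hpm).aestronglyMeasurable
      (ae_of_all _ fun x => hw01 _)
  have hL : Integrable (fun x : E n => 2 * (a * (p x).1 + b * (p x).2)) ν := by
    have h : ∀ y : E n, Integrable (fun x : E n => inner ℝ x y) ν := fun y => by
      have : Integrable (fun x : E n => innerSL ℝ y x) ν := IsGaussian.integrable_dual ν _
      simpa [real_inner_comm] using this
    exact (((h f₁).const_mul a).add ((h f₂).const_mul b)).const_mul 2
  have hS : Integrable (fun x : E n => (a * (p x).1 + b * (p x).2) ^ 2) ν := by
    refine (integrable_sq_inner (a • f₁ + b • f₂)).congr (ae_of_all _ fun x => ?_)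
    simp only [p, inner_add_right, real_inner_smul_right]
  have hZ : Integrable Z ν := by
    have : Integrable (fun x : E n => innerSL ℝ w x) ν := IsGaussian.integrable_dual ν _
    simpa [Z, real_inner_comm] using this
  have hZ0 : ∫ x, Z x ∂ν = 0 := by
    have := integral_strongDual_stdGaussian (E := E n) (innerSL ℝ w)
    simpa [Z, real_inner_comm] using this
  have hcross : ∫ x, wedge θ (p x) * (2 * (a * (p x).1 + b * (p x).2)) * Z x ∂ν = 0 := by
    have := hpZ.integral_fun_comp_mul_comp
      (f := fun q => wedge θ q * (2 * (a * q.1 + b * q.2))) (g := fun z => z)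
      hpm.aemeasurable (by fun_prop) (by fun_prop) (by fun_prop)
    rw [this, hZ0, mul_zero]
  have hcrossI : Integrable (fun x => wedge θ (p x) * (2 * (a * (p x).1 + b * (p x).2)) * Z x) ν :=
    (hpZ.comp (φ := fun q => wedge θ q * (2 * (a * q.1 + b * q.2))) (ψ := fun z => z)
      (by fun_prop) (by fun_prop)).integrable_mul (hbdd hL) hZ
  have hperp : ∫ x, wedge θ (p x) * Z x ^ 2 ∂ν = (Real.pi - θ) / (2 * Real.pi) * ‖w‖ ^ 2 := by
    have := hpZ.integral_fun_comp_mul_comp (f := wedge θ) (g := fun z => z ^ 2)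
      hpm.aemeasurable (by fun_prop) (by fun_prop) (by fun_prop)
    rw [this, hpi' _ hm, integral_wedge h0 hpi, integral_sq_inner]
  simp_rw [hsplit]
  have hZsq : Integrable (fun x => wedge θ (p x) * Z x ^ 2) ν := hbdd (integrable_sq_inner w)
  have hrest : Integrable (fun x => wedge θ (p x) * (2 * (a * (p x).1 + b * (p x).2)) * Z x +
      wedge θ (p x) * Z x ^ 2) ν := hcrossI.add hZsq
  rw [integral_add (hbdd hS) hrest, integral_add hcrossI hZsq, hcross, hperp,
    hpi' (fun q => wedge θ q * (a * q.1 + b * q.2) ^ 2) (by fun_prop),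
    integral_wedge_mul_sq h0 hpi]
  ring

/-- Every pair of unit vectors of a space of dimension at least two is `f₁`, `cos θ f₁ + sin θ f₂`
for an orthonormal pair `f₁`, `f₂`, with `θ` the angle between them. -/
theorem exists_orthonormal_frame (hn : 2 ≤ n) {p q : E n} (hp : ‖p‖ = 1) (hq : ‖q‖ = 1) :
    ∃ f : E n, ‖f‖ = 1 ∧ inner ℝ p f = 0 ∧
      q = Real.cos (InnerProductGeometry.angle p q) • p +
        Real.sin (InnerProductGeometry.angle p q) • f := by
  set θ := InnerProductGeometry.angle p q
  have hc : inner ℝ p q = Real.cos θ := by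
    rw [InnerProductGeometry.cos_angle, hp, hq]; simp
  set d := q - Real.cos θ • p
  have hpp : inner ℝ p p = (1 : ℝ) := by rw [real_inner_self_eq_norm_sq, hp, one_pow]
  have hqq : inner ℝ q q = (1 : ℝ) := by rw [real_inner_self_eq_norm_sq, hq, one_pow]
  have hpd : inner ℝ p d = 0 := by
    simp only [d, inner_sub_right, real_inner_smul_right, hc, hpp]; ring
  have hd : ‖d‖ = Real.sin θ := by
    have h1 : ‖d‖ ^ 2 = Real.sin θ ^ 2 := by
      rw [← real_inner_self_eq_norm_sq]
      simp only [d, inner_sub_left, inner_sub_right, real_inner_smul_right, real_inner_smul_left,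
        real_inner_comm p q, hc, hpp, hqq]
      linear_combination -Real.sin_sq_add_cos_sq θ
    exact (sq_eq_sq₀ (norm_nonneg _) (InnerProductGeometry.sin_angle_nonneg p q)).mp h1
  by_cases hs : Real.sin θ = 0
  · -- `q = ± p`, and any unit vector orthogonal to `p` will do
    have hd0 : d = 0 := by rw [← norm_eq_zero, hd, hs]
    have hdim : Module.finrank ℝ (ℝ ∙ p) < Module.finrank ℝ (E n) := by
      rw [finrank_euclideanSpace_fin]
      exact (finrank_span_le_card {p}).trans_lt (by simpa using (by omega : 1 < n))
    have hne : (ℝ ∙ p)ᗮ ≠ ⊥ := fun h => by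
      rw [Submodule.orthogonal_eq_bot_iff] at h
      rw [h, finrank_top] at hdim
      exact lt_irrefl _ hdim
    obtain ⟨z, hz, hz0⟩ := Submodule.exists_mem_ne_zero_of_ne_bot hne
    refine ⟨unit z, norm_unit hz0, ?_, ?_⟩
    · rw [unit, real_inner_smul_right, Submodule.mem_orthogonal_singleton_iff_inner_right.mp hz,
        mul_zero]
    · rw [hs, zero_smul, add_zero]
      exact sub_eq_zero.mp hd0
  · have hd0 : d ≠ 0 := fun h => hs (by rw [← hd, h, norm_zero])
    refine ⟨unit d, norm_unit hd0, ?_, ?_⟩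
    · rw [unit, real_inner_smul_right, hpd, mul_zero]
    · rw [unit, hd, smul_smul, mul_inv_cancel₀ hs, one_smul]
      simp [d]

/-- In the frame `r̂`, `f` of the plane of `r` and `s`, the quadratic form of `swap r s` is that
of the reflection which exchanges the directions at the angles `0` and `θ`. -/
theorem inner_swap_frame {r s : E n} (hr : r ≠ 0) (hs : s ≠ 0) {f : E n} (hf : ‖f‖ = 1)
    (hpf : inner ℝ (unit r) f = 0) {θ : ℝ} (hθ : Real.sin θ ≠ 0)
    (hq : unit s = Real.cos θ • unit r + Real.sin θ • f) {w : E n}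
    (hw₁ : inner ℝ (unit r) w = 0) (hw₂ : inner ℝ f w = 0) (a b : ℝ) :
    inner ℝ (swap r s (a • unit r + b • f + w)) (a • unit r + b • f + w) =
      (a ^ 2 - b ^ 2) * Real.cos θ + 2 * a * b * Real.sin θ := by
  have hp : ‖unit r‖ = 1 := norm_unit hr
  have hsw : swap r s w = 0 := by
    have hmem : w ∈ LinearMap.ker (swap r s : E n →ₗ[ℝ] E n) := by
      rw [ker_swap, Submodule.mem_orthogonal]
      intro y hy
      obtain ⟨c₁, c₂, rfl⟩ := Submodule.mem_span_pair.mp hy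
      have h1 : r = ‖r‖ • unit r := by
        rw [unit, smul_smul, mul_inv_cancel₀ (norm_ne_zero_iff.mpr hr), one_smul]
      have h2 : s = ‖s‖ • unit s := by
        rw [unit, smul_smul, mul_inv_cancel₀ (norm_ne_zero_iff.mpr hs), one_smul]
      rw [h1, h2, hq]
      simp only [inner_add_left, real_inner_smul_left, hw₁, hw₂, mul_zero, add_zero]
    exact hmem
  have hsf : swap r s f = Real.sin θ • unit r - Real.cos θ • f := by
    have h1 : f = (Real.sin θ)⁻¹ • (unit s - Real.cos θ • unit r) := by
      rw [hq, add_sub_cancel_left, smul_smul, inv_mul_cancel₀ hθ, one_smul]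
    have h2 : swap r s f = (Real.sin θ)⁻¹ • (unit r - Real.cos θ • unit s) := by
      conv_lhs => rw [h1]
      rw [map_smul, map_sub, map_smul, swap_unit_right hr hs, swap_unit_left hr hs]
    rw [h2, hq]
    have h3 : unit r - Real.cos θ • (Real.cos θ • unit r + Real.sin θ • f) =
        Real.sin θ • (Real.sin θ • unit r - Real.cos θ • f) := by
      have h4 : (1 : ℝ) = Real.sin θ * Real.sin θ + Real.cos θ * Real.cos θ := by
        linear_combination -Real.sin_sq_add_cos_sq θ
      nth_rewrite 1 [← one_smul ℝ (unit r)]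
      rw [h4]
      module
    rw [h3, smul_smul, inv_mul_cancel₀ hθ, one_smul]
  rw [map_add, map_add, map_smul, map_smul, swap_unit_left hr hs, hsf, hsw, hq]
  have hpp : inner ℝ (unit r) (unit r) = (1 : ℝ) := by
    rw [real_inner_self_eq_norm_sq, hp, one_pow]
  have hff : inner ℝ f f = (1 : ℝ) := by rw [real_inner_self_eq_norm_sq, hf, one_pow]
  have hfp : inner ℝ f (unit r) = (0 : ℝ) := by rw [real_inner_comm, hpf]
  simp only [inner_add_left, inner_add_right, inner_sub_left, real_inner_smul_left,
    real_inner_smul_right, hpp, hff, hpf, hfp, hw₁, hw₂, add_zero]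
  ring

/-- `Q r s` is the expectation of `1[⟨x, r⟩ > 0, ⟨x, s⟩ > 0] x xᵀ` for a standard Gaussian
vector `x`, as a quadratic form. The dimension is at least two so that the frame of the plane of
`r` and `s` exists also when `r` and `s` are parallel. -/
theorem integral_both_eq_inner_Q (hn : 2 ≤ n) {r s : E n} (hr : r ≠ 0) (hs : s ≠ 0) (u : E n) :
    ∫ x, both r s x * (inner ℝ x u) ^ 2 ∂(stdGaussian (E n)) = inner ℝ (Q r s u) u := by
  have hp := norm_unit hr
  have hr' := norm_pos_iff.mpr hr
  have hs' := norm_pos_iff.mpr hs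
  obtain ⟨f, hf, hpf, hq⟩ := exists_orthonormal_frame hn hp (norm_unit hs)
  have hang : InnerProductGeometry.angle (unit r) (unit s) = InnerProductGeometry.angle r s := by
    rw [unit, unit, InnerProductGeometry.angle_smul_left_of_pos _ _ (inv_pos.mpr hr'),
      InnerProductGeometry.angle_smul_right_of_pos _ _ (inv_pos.mpr hs')]
  rw [hang] at hq
  set θ := InnerProductGeometry.angle r s
  have hpp : inner ℝ (unit r) (unit r) = (1 : ℝ) := by
    rw [real_inner_self_eq_norm_sq, hp, one_pow]
  have hff : inner ℝ f f = (1 : ℝ) := by rw [real_inner_self_eq_norm_sq, hf, one_pow]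
  have hfp : inner ℝ f (unit r) = (0 : ℝ) := by rw [real_inner_comm, hpf]
  obtain ⟨a, b, w, hw₁, hw₂, rfl⟩ : ∃ (a b : ℝ) (w : E n), inner ℝ (unit r) w = 0 ∧
      inner ℝ f w = 0 ∧ u = a • unit r + b • f + w := by
    refine ⟨inner ℝ (unit r) u, inner ℝ f u,
      u - inner ℝ (unit r) u • unit r - inner ℝ f u • f, ?_, ?_, by abel⟩
    · simp only [inner_sub_right, real_inner_smul_right, hpp, hpf]; ring
    · simp only [inner_sub_right, real_inner_smul_right, hff, hfp]; ring
  have hb : ∀ x, both r s x = both (unit r) (Real.cos θ • unit r + Real.sin θ • f) x := fun x => by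
    rw [← hq, unit, unit, both_smul (inv_pos.mpr hr') (inv_pos.mpr hs')]
  simp_rw [hb]
  rw [integral_both_mul_sq hp hf hpf hw₁ hw₂ (InnerProductGeometry.angle_nonneg r s)
    (InnerProductGeometry.angle_le_pi r s), Q, if_neg (by tauto)]
  have hnorm : ‖a • unit r + b • f + w‖ ^ 2 = a ^ 2 + b ^ 2 + ‖w‖ ^ 2 := by
    have h1 : inner ℝ w (unit r) = (0 : ℝ) := by rw [real_inner_comm, hw₁]
    have h2 : inner ℝ w f = (0 : ℝ) := by rw [real_inner_comm, hw₂]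
    rw [← real_inner_self_eq_norm_sq, ← real_inner_self_eq_norm_sq w]
    simp only [inner_add_left, inner_add_right, real_inner_smul_left, real_inner_smul_right,
      hpp, hff, hpf, hfp, hw₁, hw₂, h1, h2]
    ring
  have hQ : ∀ (c₁ c₂ : ℝ) (x : E n),
      inner ℝ ((c₁ • ContinuousLinearMap.id ℝ (E n) + c₂ • swap r s) x) x =
      c₁ * ‖x‖ ^ 2 + c₂ * inner ℝ (swap r s x) x := fun c₁ c₂ x => by
    rw [add_apply, smul_apply, smul_apply, inner_add_left, real_inner_smul_left,
      real_inner_smul_left, ContinuousLinearMap.id_apply, real_inner_self_eq_norm_sq]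
  rw [hQ, hnorm]
  by_cases hθ : Real.sin θ = 0
  · rw [hθ]; ring
  · rw [inner_swap_frame hr hs hf hpf hθ hq hw₁ hw₂]

end

section

variable {n : ℕ}

/-! ### Perturbation of the masks -/

/-- The part of the square `⟨x, u⟩²` where `x` is within `δ` of the hyperplane orthogonal
to `r`. -/
def near (δ : ℝ) (r u x : E n) : ℝ := if |inner ℝ x r| ≤ δ then (inner ℝ x u) ^ 2 else 0

theorem near_nonneg (δ : ℝ) (r u x : E n) : 0 ≤ near δ r u x := by
  unfold near; split_ifs <;> positivity

theorem near_le (δ : ℝ) (r u x : E n) : near δ r u x ≤ (inner ℝ x u) ^ 2 := by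
  unfold near; split_ifs
  · exact le_rfl
  · positivity

theorem measurable_near (δ : ℝ) (r u : E n) : Measurable (near δ r u) := by
  have h : MeasurableSet {x : E n | |inner ℝ x r| ≤ δ} :=
    measurableSet_le (by fun_prop) (by fun_prop)
  exact Measurable.ite h (by fun_prop) measurable_const

theorem tail_nonneg (t : ℝ) (u x : E n) : 0 ≤ tail t u x := by
  unfold tail; split_ifs <;> positivity

theorem tail_le (t : ℝ) (u x : E n) : tail t u x ≤ (inner ℝ x u) ^ 2 := by
  unfold tail; split_ifs
  · exact le_rfl
  · positivity

theorem measurable_tail (t : ℝ) (u : E n) : Measurable (tail t u) := by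
  have h : MeasurableSet {x : E n | t < |inner ℝ x u|} :=
    measurableSet_lt (by fun_prop) (by fun_prop)
  exact Measurable.ite h (by fun_prop) measurable_const

/-- If `⟨x, r⟩` and `⟨x, r₀⟩` do not have the same sign, then `|⟨x, r₀⟩| ≤ |⟨x, r - r₀⟩|`. Hence
`x` is near the hyperplane of `r₀`, or `|⟨x, r - r₀⟩|` exceeds `δ`. -/
theorem sq_le_of_sign_change {δ t : ℝ} (hδ : 0 < δ) (ht : 0 < t) {r r₀ x : E n} (u : E n)
    (h : ¬(0 < inner ℝ x r ↔ 0 < inner ℝ x r₀)) :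
    (inner ℝ x u) ^ 2 ≤ near δ r₀ u x + tail t u x +
      t ^ 2 / δ ^ 2 * (inner ℝ x (r - r₀)) ^ 2 := by
  have hn := near_nonneg δ r₀ u x
  have ht0 := tail_nonneg t u x
  have hp : 0 ≤ t ^ 2 / δ ^ 2 * (inner ℝ x (r - r₀)) ^ 2 := by positivity
  by_cases h1 : |inner ℝ x r₀| ≤ δ
  · have : near δ r₀ u x = (inner ℝ x u) ^ 2 := if_pos h1
    linarith
  by_cases h2 : t < |inner ℝ x u|
  · have : tail t u x = (inner ℝ x u) ^ 2 := if_pos h2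
    linarith
  have h3 : |inner ℝ x r₀| ≤ |inner ℝ x (r - r₀)| := by
    rw [inner_sub_right]
    by_cases hr : 0 < inner ℝ x r
    · have hr₀ : inner ℝ x r₀ ≤ 0 := by by_contra hc; exact h ⟨fun _ => not_le.mp hc, fun _ => hr⟩
      rw [abs_of_nonpos hr₀, abs_of_nonneg (by linarith)]
      linarith
    · have hr₀ : 0 < inner ℝ x r₀ := by
        by_contra hc
        exact h ⟨fun h => absurd h hr, fun h => absurd h hc⟩
      rw [abs_of_pos hr₀, abs_of_nonpos (by linarith [not_lt.mp hr])]
      linarith [not_lt.mp hr]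
  have h4 : δ ^ 2 ≤ (inner ℝ x (r - r₀)) ^ 2 := by
    rw [← sq_abs (inner ℝ x (r - r₀))]
    exact pow_le_pow_left₀ hδ.le ((not_le.mp h1).le.trans h3) 2
  have h5 : (inner ℝ x u) ^ 2 ≤ t ^ 2 := by
    rw [← sq_abs (inner ℝ x u)]
    exact pow_le_pow_left₀ (abs_nonneg _) (not_lt.mp h2) 2
  have h6 : t ^ 2 ≤ t ^ 2 / δ ^ 2 * (inner ℝ x (r - r₀)) ^ 2 := by
    rw [div_mul_eq_mul_div, le_div_iff₀ (by positivity)]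
    gcongr
  linarith

theorem abs_both_sub_mul_sq_le {δ t : ℝ} (hδ : 0 < δ) (ht : 0 < t) (r r₀ s s₀ u x : E n) :
    |both r s x * (inner ℝ x u) ^ 2 - both r₀ s₀ x * (inner ℝ x u) ^ 2| ≤
      near δ r₀ u x + near δ s₀ u x + 2 * tail t u x +
        t ^ 2 / δ ^ 2 * ((inner ℝ x (r - r₀)) ^ 2 + (inner ℝ x (s - s₀)) ^ 2) := by
  have hr0 := near_nonneg δ r₀ u x
  have hs0 := near_nonneg δ s₀ u x
  have ht0 := tail_nonneg t u x
  have hp : 0 ≤ t ^ 2 / δ ^ 2 * (inner ℝ x (r - r₀)) ^ 2 := by positivity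
  have hq : 0 ≤ t ^ 2 / δ ^ 2 * (inner ℝ x (s - s₀)) ^ 2 := by positivity
  have hle : |both r s x * (inner ℝ x u) ^ 2 - both r₀ s₀ x * (inner ℝ x u) ^ 2| ≤
      (inner ℝ x u) ^ 2 := by
    rw [← sub_mul, abs_mul, abs_of_nonneg (sq_nonneg (inner ℝ x u))]
    refine mul_le_of_le_one_left (sq_nonneg _) (abs_le.mpr ?_)
    constructor <;> linarith [both_nonneg r s x, both_le_one r s x, both_nonneg r₀ s₀ x,
      both_le_one r₀ s₀ x]
  by_cases h1 : (0 < inner ℝ x r ↔ 0 < inner ℝ x r₀)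
  · by_cases h2 : (0 < inner ℝ x s ↔ 0 < inner ℝ x s₀)
    · have : both r s x = both r₀ s₀ x := by simp only [both, h1, h2]
      rw [this, sub_self, abs_zero]
      linarith
    · linarith [sq_le_of_sign_change hδ ht u h2]
  · linarith [sq_le_of_sign_change hδ ht u h1]

/-- The change of a masked second moment under a perturbation of the two masks, for an arbitrary
measure with second moments. -/
theorem abs_integral_both_sub_le {δ t : ℝ} (hδ : 0 < δ) (ht : 0 < t) {μ : Measure (E n)}
    (hμ : ∀ y : E n, Integrable (fun x : E n => (inner ℝ x y) ^ 2) μ) (r r₀ s s₀ u : E n) :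
    |∫ x, both r s x * (inner ℝ x u) ^ 2 ∂μ - ∫ x, both r₀ s₀ x * (inner ℝ x u) ^ 2 ∂μ| ≤
      ∫ x, near δ r₀ u x ∂μ + ∫ x, near δ s₀ u x ∂μ + 2 * ∫ x, tail t u x ∂μ +
        t ^ 2 / δ ^ 2 * (∫ x, (inner ℝ x (r - r₀)) ^ 2 ∂μ + ∫ x, (inner ℝ x (s - s₀)) ^ 2 ∂μ) := by
  have hb : ∀ r s : E n, Integrable (fun x => both r s x * (inner ℝ x u) ^ 2) μ := fun r s =>
    (hμ u).bdd_mul (c := 1) (measurable_both r s).aestronglyMeasurable (ae_of_all _ fun x => by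
      rw [Real.norm_eq_abs, abs_of_nonneg (both_nonneg r s x)]; exact both_le_one r s x)
  have hn : ∀ r : E n, Integrable (near δ r u) μ := fun r =>
    (hμ u).mono' (measurable_near δ r u).aestronglyMeasurable (ae_of_all _ fun x => by
      rw [Real.norm_eq_abs, abs_of_nonneg (near_nonneg δ r u x)]; exact near_le δ r u x)
  have ht' : Integrable (tail t u) μ :=
    (hμ u).mono' (measurable_tail t u).aestronglyMeasurable (ae_of_all _ fun x => by
      rw [Real.norm_eq_abs, abs_of_nonneg (tail_nonneg t u x)]; exact tail_le t u x)
  have i1 : Integrable (fun x => near δ r₀ u x + near δ s₀ u x) μ := (hn r₀).add (hn s₀)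
  have i2 : Integrable (fun x => near δ r₀ u x + near δ s₀ u x + 2 * tail t u x) μ :=
    i1.add (ht'.const_mul 2)
  have i3 : Integrable (fun x : E n => (inner ℝ x (r - r₀)) ^ 2 + (inner ℝ x (s - s₀)) ^ 2) μ :=
    (hμ _).add (hμ _)
  have i4 : Integrable (fun x : E n => near δ r₀ u x + near δ s₀ u x + 2 * tail t u x +
      t ^ 2 / δ ^ 2 * ((inner ℝ x (r - r₀)) ^ 2 + (inner ℝ x (s - s₀)) ^ 2)) μ :=
    i2.add (i3.const_mul _)
  rw [← integral_sub (hb r s) (hb r₀ s₀)]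
  refine abs_integral_le_integral_abs.trans ?_
  refine (integral_mono ((hb r s).sub (hb r₀ s₀)).abs i4
    (abs_both_sub_mul_sq_le hδ ht r r₀ s s₀ u)).trans (le_of_eq ?_)
  rw [integral_add i2 (i3.const_mul _), integral_add i1 (ht'.const_mul 2),
    integral_add (hn r₀) (hn s₀), integral_const_mul, integral_const_mul,
    integral_add (hμ _) (hμ _)]

/-- Truncation of `⟨x, u⟩²` at the level `t²` bounds its Gaussian mean over a slab without using the
joint law of `⟨x, u⟩` and `⟨x, r⟩`. -/
theorem integral_near_le {δ t : ℝ} (hδ : 0 < δ) (ht : 0 < t) {r u : E n} (hr : ‖r‖ = 1)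
    (hu : ‖u‖ = 1) :
    ∫ x, near δ r u x ∂(stdGaussian (E n)) ≤ t ^ 2 * δ + 48 / t ^ 2 := by
  set A : Set (E n) := {x | |inner ℝ x r| ≤ δ}
  have hA : MeasurableSet A := measurableSet_le (by fun_prop) (by fun_prop)
  have ht' : Integrable (tail t u) (stdGaussian (E n)) :=
    (integrable_sq_inner u).mono' (measurable_tail t u).aestronglyMeasurable
      (ae_of_all _ fun x => by
        rw [Real.norm_eq_abs, abs_of_nonneg (tail_nonneg t u x)]; exact tail_le t u x)
  have hAi : Integrable (A.indicator fun _ => t ^ 2) (stdGaussian (E n)) :=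
    (integrable_const _).indicator hA
  have hle : ∀ x, near δ r u x ≤ A.indicator (fun _ => t ^ 2) x + tail t u x := fun x => by
    by_cases hx : x ∈ A
    · rw [Set.indicator_of_mem hx]
      by_cases h2 : t < |inner ℝ x u|
      · have : tail t u x = (inner ℝ x u) ^ 2 := if_pos h2
        rw [this]
        linarith [near_le δ r u x, sq_nonneg t]
      · have h5 : (inner ℝ x u) ^ 2 ≤ t ^ 2 := by
          rw [← sq_abs (inner ℝ x u)]
          exact pow_le_pow_left₀ (abs_nonneg _) (not_lt.mp h2) 2
        linarith [near_le δ r u x, tail_nonneg t u x]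
    · have : near δ r u x = 0 := if_neg hx
      rw [Set.indicator_of_notMem hx, this, zero_add]
      exact tail_nonneg t u x
  calc ∫ x, near δ r u x ∂(stdGaussian (E n))
      ≤ ∫ x, A.indicator (fun _ => t ^ 2) x + tail t u x ∂(stdGaussian (E n)) :=
        integral_mono_of_nonneg (ae_of_all _ (near_nonneg δ r u)) (hAi.add ht')
          (ae_of_all _ hle)
    _ = t ^ 2 * (stdGaussian (E n)).real A + ∫ x, tail t u x ∂(stdGaussian (E n)) := by
      rw [integral_add hAi ht', integral_indicator_const _ hA, smul_eq_mul, mul_comm]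
    _ ≤ t ^ 2 * δ + 48 / t ^ 2 := by
      gcongr
      · exact stdGaussian_abs_inner_le hr hδ.le
      · exact integral_tail_le hu ht

/-! ### Empirical measures -/

/-- The uniform probability measure on the sample `g`. -/
def empMeasure {m : ℕ} (g : Fin m → E n) : Measure (E n) :=
  (m : NNReal)⁻¹ • ∑ i, Measure.dirac (g i)

theorem integrable_empMeasure {m : ℕ} (g : Fin m → E n) (f : E n → ℝ) :
    Integrable f (empMeasure g) := by
  refine Integrable.smul_measure_nnreal ?_
  rw [integrable_finsetSum_measure]
  exact fun i _ => integrable_dirac (by simp)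

theorem integral_empMeasure {m : ℕ} (g : Fin m → E n) (f : E n → ℝ) :
    ∫ x, f x ∂(empMeasure g) = empMean g f := by
  rw [empMeasure, integral_smul_nnreal_measure,
    integral_finsetSum_measure fun i _ => integrable_dirac (by simp)]
  simp only [integral_dirac]
  rw [NNReal.smul_def]
  simp [empMean]

end

section

variable {n : ℕ}

/-! ### Nets and quadratic forms -/

/-- Volume bound: the balls of radius `δ / 2` around the points are disjoint and lie in the ball of
radius `1 + δ / 2`. -/
theorem card_le_of_separated {V : Type*} [NormedAddCommGroup V] [NormedSpace ℝ V]
    [FiniteDimensional ℝ V] {δ : ℝ} (hδ : 0 < δ) (s : Finset V) (hs : ∀ c ∈ s, ‖c‖ = 1)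
    (h : ∀ c ∈ s, ∀ d ∈ s, c ≠ d → δ ≤ ‖c - d‖) :
    (s.card : ℝ) ≤ (1 + 2 / δ) ^ Module.finrank ℝ V := by
  borelize V
  let μ : Measure V := Measure.addHaar
  have hδ2 : 0 < δ / 2 := by positivity
  have hρ : 0 < 1 + δ / 2 := by positivity
  have hD : Set.PairwiseDisjoint (s : Set V) fun c => Metric.ball c (δ / 2) := by
    rintro c hc d hd hcd
    refine Metric.ball_disjoint_ball ?_
    rw [dist_eq_norm, add_halves]
    exact h c hc d hd hcd
  have hA : ⋃ c ∈ s, Metric.ball c (δ / 2) ⊆ Metric.ball (0 : V) (1 + δ / 2) := by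
    refine Set.iUnion₂_subset fun x hx => Metric.ball_subset_ball' ?_
    rw [dist_zero_right, hs x hx, add_comm]
  have hI : (s.card : ENNReal) * ENNReal.ofReal ((δ / 2) ^ Module.finrank ℝ V) *
      μ (Metric.ball 0 1) ≤
      ENNReal.ofReal ((1 + δ / 2) ^ Module.finrank ℝ V) * μ (Metric.ball 0 1) := by
    rw [← μ.addHaar_ball_of_pos 0 hρ]
    refine le_trans (le_of_eq ?_) (measure_mono hA)
    rw [measure_biUnion_finset hD fun c _ => measurableSet_ball]
    simp only [μ.addHaar_ball_of_pos _ hδ2, Finset.sum_const, nsmul_eq_mul, mul_assoc]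
  have hJ := (ENNReal.mul_le_mul_iff_left
    (Metric.measure_ball_pos μ _ zero_lt_one).ne' measure_ball_lt_top.ne).1 hI
  have hK := ENNReal.toReal_le_of_le_ofReal (by positivity) hJ
  rw [ENNReal.toReal_mul, ENNReal.toReal_natCast, ENNReal.toReal_ofReal (by positivity),
    ← le_div_iff₀ (by positivity), ← div_pow] at hK
  refine hK.trans (le_of_eq ?_)
  congr 1
  field_simp
  ring

/-- A `δ`-net of the unit sphere of a subspace; a maximal `δ`-separated subset is one. -/
theorem exists_net (T : Submodule ℝ (E n)) {δ : ℝ} (hδ : 0 < δ) :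
    ∃ N : Finset (E n), (∀ u ∈ N, u ∈ T ∧ ‖u‖ = 1) ∧
      (N.card : ℝ) ≤ Real.exp (2 / δ * Module.finrank ℝ T) ∧
      ∀ u ∈ T, ‖u‖ = 1 → ∃ u₀ ∈ N, ‖u - u₀‖ ≤ δ := by
  classical
  set S : Set ℕ := {k | ∃ s : Finset T, s.card = k ∧ (∀ c ∈ s, ‖c‖ = 1) ∧
    ∀ c ∈ s, ∀ d ∈ s, c ≠ d → δ ≤ ‖c - d‖}
  have hbd : BddAbove S := by
    refine ⟨⌊(1 + 2 / δ) ^ Module.finrank ℝ T⌋₊, ?_⟩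
    rintro k ⟨s, rfl, h1, h2⟩
    exact Nat.le_floor (card_le_of_separated hδ s h1 h2)
  obtain ⟨s, hcard, h1, h2⟩ := Nat.sSup_mem (s := S) ⟨0, ∅, by simp⟩ hbd
  refine ⟨s.map (Function.Embedding.subtype _), ?_, ?_, ?_⟩
  · intro u hu
    obtain ⟨c, hc, rfl⟩ := Finset.mem_map.mp hu
    exact ⟨c.2, h1 c hc⟩
  · rw [Finset.card_map]
    refine (card_le_of_separated hδ s h1 h2).trans ?_
    rw [mul_comm, Real.exp_nat_mul, add_comm]
    exact pow_le_pow_left₀ (by positivity) (Real.add_one_le_exp _) _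
  · intro u hu hu1
    by_contra! hc
    have hfar : ∀ c ∈ s, δ < ‖(⟨u, hu⟩ : T) - c‖ := fun c hc' =>
      hc c (Finset.mem_map.mpr ⟨c, hc', rfl⟩)
    have hnot : (⟨u, hu⟩ : T) ∉ s := fun hm => by
      have := hfar _ hm
      rw [sub_self, norm_zero] at this
      linarith
    have hmem : s.card + 1 ∈ S := by
      refine ⟨insert ⟨u, hu⟩ s, Finset.card_insert_of_notMem hnot, ?_, ?_⟩
      · intro c hc'
        rcases Finset.mem_insert.mp hc' with rfl | h
        · exact hu1
        · exact h1 c h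
      · intro c hc' d hd hcd
        rcases Finset.mem_insert.mp hc' with rfl | h
        · rcases Finset.mem_insert.mp hd with rfl | h'
          · exact absurd rfl hcd
          · exact (hfar d h').le
        · rcases Finset.mem_insert.mp hd with rfl | h'
          · rw [norm_sub_rev]; exact (hfar c h).le
          · exact h2 c h d h' hcd
    have := le_csSup hbd hmem
    omega

/-- Polarization: a symmetric bilinear form is controlled by its quadratic form. -/
theorem abs_bilin_le {B : LinearMap.BilinForm ℝ (E n)} (hB : B.IsSymm)
    {T : Submodule ℝ (E n)} {K : ℝ} (hK : ∀ x ∈ T, |B x x| ≤ K * ‖x‖ ^ 2) {x y : E n}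
    (hx : x ∈ T) (hy : y ∈ T) : |B x y| ≤ K * ‖x‖ * ‖y‖ := by
  by_cases hx0 : x = 0
  · simp [hx0]
  by_cases hy0 : y = 0
  · simp [hy0]
  have hx' := norm_pos_iff.mpr hx0
  have hy' := norm_pos_iff.mpr hy0
  set a := ‖y‖ • x
  set b := ‖x‖ • y
  have ha : a ∈ T := T.smul_mem _ hx
  have hb : b ∈ T := T.smul_mem _ hy
  have hab : B a b = ‖x‖ * ‖y‖ * B x y := by
    simp only [a, b, map_smul, LinearMap.smul_apply, smul_eq_mul]; ring
  have hna : ‖a‖ = ‖x‖ * ‖y‖ := by simp [a, norm_smul, mul_comm]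
  have hnb : ‖b‖ = ‖x‖ * ‖y‖ := by simp [b, norm_smul]
  have hsym : B b a = B a b := hB.eq b a
  have hpol : 4 * B a b = B (a + b) (a + b) - B (a - b) (a - b) := by
    simp only [map_add, map_sub, LinearMap.add_apply, LinearMap.sub_apply, hsym]; ring
  have hpar := parallelogram_law_with_norm ℝ a b
  have h1 := hK _ (T.add_mem ha hb)
  have h2 := hK _ (T.sub_mem ha hb)
  have h3 : |4 * B a b| ≤ 4 * (K * (‖x‖ * ‖y‖) ^ 2) := by
    rw [hpol]
    refine (abs_sub _ _).trans ?_
    calc _ ≤ K * ‖a + b‖ ^ 2 + K * ‖a - b‖ ^ 2 := add_le_add h1 h2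
      _ = K * (2 * (‖a‖ ^ 2 + ‖b‖ ^ 2)) := by rw [← hpar]; ring
      _ = _ := by rw [hna, hnb]; ring
  rw [abs_mul, hab, abs_mul, abs_of_pos (by norm_num : (0 : ℝ) < 4),
    abs_of_pos (mul_pos hx' hy')] at h3
  have h4 : ‖x‖ * ‖y‖ * |B x y| ≤ ‖x‖ * ‖y‖ * (K * ‖x‖ * ‖y‖) := by nlinarith
  exact le_of_mul_le_mul_left h4 (mul_pos hx' hy')

theorem continuous_bilin_self (B : LinearMap.BilinForm ℝ (E n)) : Continuous fun x => B x x := by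
  change Continuous fun x => B.toContinuousBilinearMap x x
  fun_prop

/-- A bound for a quadratic form on a `1/4`-net of the unit sphere of a subspace extends to the
subspace, at the cost of a factor two: at a maximizer on the sphere the form differs from its value
at a nearby net point by at most half of the maximum. -/
theorem abs_bilin_self_le_of_net {B : LinearMap.BilinForm ℝ (E n)} (hB : B.IsSymm)
    {T : Submodule ℝ (E n)} {N : Finset (E n)} (hN : ∀ u ∈ N, u ∈ T ∧ ‖u‖ = 1)
    (hnet : ∀ u ∈ T, ‖u‖ = 1 → ∃ u₀ ∈ N, ‖u - u₀‖ ≤ 1 / 4) {η : ℝ}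
    (hη : ∀ u ∈ N, |B u u| ≤ η) {x : E n} (hx : x ∈ T) : |B x x| ≤ 2 * η * ‖x‖ ^ 2 := by
  by_cases hx0 : x = 0
  · simp [hx0]
  have hunit : ∀ {y : E n}, y ≠ 0 → B y y = ‖y‖ ^ 2 * B (unit y) (unit y) := fun {y} hy => by
    have : ‖y‖ ≠ 0 := norm_ne_zero_iff.mpr hy
    simp only [unit, map_smul, LinearMap.smul_apply, smul_eq_mul]
    field_simp
  have hcomp : IsCompact ((T : Set (E n)) ∩ Metric.sphere 0 1) :=
    (isCompact_sphere _ _).inter_left T.closed_of_finiteDimensional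
  have hne : ((T : Set (E n)) ∩ Metric.sphere 0 1).Nonempty :=
    ⟨unit x, T.smul_mem _ hx, by simp [norm_unit hx0]⟩
  obtain ⟨z, ⟨hzT, hz⟩, hmax⟩ := hcomp.exists_isMaxOn hne (continuous_bilin_self B).abs.continuousOn
  have hz1 : ‖z‖ = 1 := by simpa using hz
  have hKT : ∀ y ∈ T, |B y y| ≤ |B z z| * ‖y‖ ^ 2 := fun y hy => by
    by_cases hy0 : y = 0
    · simp [hy0]
    rw [hunit hy0, abs_mul, abs_of_nonneg (sq_nonneg _), mul_comm]
    exact mul_le_mul_of_nonneg_right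
      (hmax (a := unit y) ⟨T.smul_mem _ hy, by simp [norm_unit hy0]⟩) (sq_nonneg _)
  obtain ⟨u, hu, hzu⟩ := hnet z hzT hz1
  obtain ⟨huT, hu1⟩ := hN u hu
  have hdiff : B z z = B u u + B (z - u) (z + u) := by
    have := hB.eq z u
    simp only [map_add, map_sub, LinearMap.sub_apply]
    linarith [show B z u = B u z from this]
  have hp := abs_bilin_le hB hKT (T.sub_mem hzT huT) (T.add_mem hzT huT)
  have hzu2 : ‖z + u‖ ≤ 2 := (norm_add_le _ _).trans (by rw [hz1, hu1]; norm_num)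
  have hp2 : |B z z| * ‖z - u‖ * ‖z + u‖ ≤ |B z z| * (1 / 4) * 2 := by gcongr
  have h1 : |B z z| ≤ |B u u| + |B (z - u) (z + u)| := by
    conv_lhs => rw [hdiff]
    exact abs_add_le _ _
  have h2 : |B z z| ≤ 2 * η := by linarith [hη u hu]
  exact (hKT x hx).trans (by gcongr)

end

section

variable {m n : ℕ}

/-! ### Rows of a Gaussian matrix -/

/-- The `i`-th row of the `m`-rowed matrix `W`, scaled by `√m`. -/
def row (W : Matrix (Fin m) (Fin n) ℝ) (i : Fin m) : E n :=
  WithLp.toLp 2 fun j => √m * W i j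

section
variable {Ω : Type*} [MeasurableSpace Ω] {P : Measure Ω} {W : Ω → Matrix (Fin m) (Fin n) ℝ}

/-- Currying turns the joint law of the scaled entries into a product of the laws of the rows. -/
theorem IsGaussianMatrix.map_scaled [IsProbabilityMeasure P]
    (hW : IsGaussianMatrix P W) (hm : 0 < m) :
    P.map (fun ω i j => √m * W ω i j) =
      Measure.infinitePi fun _ : Fin m => Measure.infinitePi fun _ : Fin n => gaussianReal 0 1 := by
  have hm' : (m : NNReal) ≠ 0 := by exact_mod_cast hm.ne'
  have hlaw : ∀ p : Fin m × Fin n,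
      P.map (fun ω => √m * W ω p.1 p.2) = gaussianReal 0 1 := fun p => by
    have h := gaussianReal_const_mul (hW.hasLaw p.1 p.2) (√m)
    have h2 := h.map_eq
    rw [h2, mul_zero]
    congr 1
    ext
    simp [Real.sq_sqrt, hm.ne']
  have hmeas : ∀ p : Fin m × Fin n, AEMeasurable (fun ω => √m * W ω p.1 p.2) P := fun p =>
    (hW.hasLaw p.1 p.2).aemeasurable.const_mul _
  have hind : iIndepFun (fun (p : Fin m × Fin n) ω => √m * W ω p.1 p.2) P :=
    hW.indep.comp (fun _ x => √m * x) (fun _ => by fun_prop)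
  have hmap := (iIndepFun_iff_map_fun_eq_infinitePi_map₀' hmeas).mp hind
  simp_rw [hlaw] at hmap
  rw [← Measure.infinitePi_map_curry (fun _ _ => gaussianReal 0 1), ← hmap,
    AEMeasurable.map_map_of_aemeasurable (by fun_prop) (aemeasurable_pi_lambda _ hmeas)]
  rfl

theorem IsGaussianMatrix.map_scaled_row [IsProbabilityMeasure P]
    (hW : IsGaussianMatrix P W) (hm : 0 < m) (i : Fin m) :
    P.map (fun ω j => √m * W ω i j) =
      Measure.infinitePi fun _ : Fin n => gaussianReal 0 1 := by
  have hmeas : AEMeasurable (fun ω i j => √m * W ω i j) P :=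
    aemeasurable_pi_lambda _ fun i => aemeasurable_pi_lambda _ fun j =>
      (hW.hasLaw i j).aemeasurable.const_mul _
  rw [← Measure.infinitePi_map_eval
      (fun _ : Fin m => Measure.infinitePi fun _ : Fin n => gaussianReal 0 1) i,
    ← hW.map_scaled hm,
    AEMeasurable.map_map_of_aemeasurable (measurable_pi_apply i).aemeasurable hmeas]
  rfl

theorem IsGaussianMatrix.aemeasurable_scaled_row (hW : IsGaussianMatrix P W) (i : Fin m) :
    AEMeasurable (fun ω j => √m * W ω i j) P :=
  aemeasurable_pi_lambda _ fun j => (hW.hasLaw i j).aemeasurable.const_mul _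

theorem IsGaussianMatrix.hasLaw_row [IsProbabilityMeasure P]
    (hW : IsGaussianMatrix P W) (hm : 0 < m) (i : Fin m) :
    HasLaw (fun ω => row (W ω) i) (stdGaussian (E n)) P := by
  have hmeas := hW.aemeasurable_scaled_row i
  refine ⟨(by fun_prop : Measurable (WithLp.toLp 2)).comp_aemeasurable hmeas, ?_⟩
  rw [← map_pi_eq_stdGaussian, ← Measure.infinitePi_eq_pi, ← hW.map_scaled_row hm i,
    AEMeasurable.map_map_of_aemeasurable (by fun_prop) hmeas]
  rfl

theorem IsGaussianMatrix.iIndepFun_row [IsProbabilityMeasure P]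
    (hW : IsGaussianMatrix P W) (hm : 0 < m) :
    iIndepFun (fun i ω => row (W ω) i) P := by
  have hind : iIndepFun (fun i ω j => √m * W ω i j) P := by
    rw [iIndepFun_iff_map_fun_eq_infinitePi_map₀' hW.aemeasurable_scaled_row, hW.map_scaled hm]
    simp_rw [hW.map_scaled_row hm]
  exact hind.comp (fun _ => WithLp.toLp 2) fun _ => by fun_prop

end

theorem inner_row (W : Matrix (Fin m) (Fin n) ℝ) (i : Fin m) (u : E n) :
    inner ℝ (row W i) u = √m * (W *ᵥ u.ofLp) i := by
  simp only [row, PiLp.inner_apply, Matrix.mulVec, dotProduct, Finset.mul_sum]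
  refine Finset.sum_congr rfl fun j _ => ?_
  simp
  ring

/-- The masked Gram form as an empirical mean over the scaled rows. -/
theorem inner_plus_eq (W : Matrix (Fin m) (Fin n) ℝ) (r s u v : E n) :
    inner ℝ (Matrix.toEuclideanLin ((plus W r)ᵀ * plus W s) u) v =
      empMean (row W) fun x => both r s x * (inner ℝ x u * inner ℝ x v) := by
  rcases Nat.eq_zero_or_pos m with rfl | hm
  · simp [empMean]
  have hm' : (0 : ℝ) < m := Nat.cast_pos.mpr hm
  have hs : 0 < √(m : ℝ) := Real.sqrt_pos.mpr hm'
  have hplus : ∀ (r u : E n) (i : Fin m), (plus W r *ᵥ u.ofLp) i =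
      (if 0 < (W *ᵥ r.ofLp) i then (1 : ℝ) else 0) * (W *ᵥ u.ofLp) i := fun r u i => by
    rw [plus, ← Matrix.mulVec_mulVec, Matrix.mulVec_diagonal]
  have h1 : inner ℝ (Matrix.toEuclideanLin ((plus W r)ᵀ * plus W s) u) v =
      (plus W s *ᵥ u.ofLp) ⬝ᵥ (plus W r *ᵥ v.ofLp) := by
    rw [Matrix.toLpLin_apply, ← Matrix.mulVec_mulVec, EuclideanSpace.inner_eq_star_dotProduct,
      Matrix.mulVec_transpose, Matrix.dotProduct_mulVec]
    simp [dotProduct_comm]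
  rw [h1, dotProduct, empMean, Finset.mul_sum]
  refine Finset.sum_congr rfl fun i _ => ?_
  simp only [hplus, both, inner_row, mul_pos_iff_of_pos_left hs]
  have hsq : (m : ℝ)⁻¹ * (√m * √m) = 1 := by
    rw [Real.mul_self_sqrt hm'.le, inv_mul_cancel₀ hm'.ne']
  by_cases h2 : 0 < (W *ᵥ r.ofLp) i <;> by_cases h3 : 0 < (W *ᵥ s.ofLp) i <;>
    simp only [h2, h3, and_self, and_true, and_false, if_true, if_false, one_mul,
      zero_mul, mul_zero]
  linear_combination -((W *ᵥ u.ofLp) i * (W *ᵥ v.ofLp) i) * hsq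

/-! ### Symmetry of the limiting operator -/

/-- The reflection in `swap r s` maps `span {r, s}` to itself, so it commutes with the
projection. -/
theorem inner_swap_comm (r s u v : E n) : inner ℝ (swap r s u) v = inner ℝ (swap r s v) u := by
  set K := Submodule.span ℝ {r, s}
  set d := unit r - unit s
  have hd : d ∈ K := K.sub_mem (K.smul_mem _ (Submodule.subset_span (by simp)))
    (K.smul_mem _ (Submodule.subset_span (by simp)))
  have hsw : ∀ x : E n, swap r s x =
      K.starProjection x - (2 * (inner ℝ d x / ‖d‖ ^ 2)) • d := fun x => by
    have h1 : inner ℝ d (K.starProjection x) = inner ℝ d x := by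
      rw [← Submodule.inner_starProjection_left_eq_right,
        Submodule.starProjection_eq_self_iff.mpr hd]
    change (ℝ ∙ d)ᗮ.reflection (K.starProjection x) = _
    rw [Submodule.reflection_orthogonal_apply, Submodule.reflection_singleton_apply, h1]
    simp only [two_smul, mul_smul]
    simp
  clear_value d
  rw [hsw, hsw, inner_sub_left, inner_sub_left, real_inner_smul_left, real_inner_smul_left,
    Submodule.inner_starProjection_left_eq_right,
    real_inner_comm (K.starProjection v) u]
  ring

theorem inner_Q_comm (r s u v : E n) : inner ℝ (Q r s u) v = inner ℝ (Q r s v) u := by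
  unfold Q
  split_ifs
  · simp
  · rw [add_apply, add_apply, smul_apply, smul_apply, smul_apply, smul_apply, inner_add_left,
      inner_add_left, real_inner_smul_left, real_inner_smul_left, real_inner_smul_left,
      real_inner_smul_left, inner_swap_comm r s u v, ContinuousLinearMap.id_apply,
      ContinuousLinearMap.id_apply, real_inner_comm v u]

/-- The bilinear form `(u, v) ↦ m⁻¹ ∑ᵢ c(gᵢ) ⟨gᵢ, u⟩ ⟨gᵢ, v⟩` of a weighted sample `g`. -/
def sampleForm (g : Fin m → E n) (c : E n → ℝ) : LinearMap.BilinForm ℝ (E n) :=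
  LinearMap.mk₂ ℝ (fun u v => empMean g fun x => c x * (inner ℝ x u * inner ℝ x v))
    (fun u u' v => by
      simp only [empMean, inner_add_right, ← mul_add, ← Finset.sum_add_distrib]
      congr 1; refine Finset.sum_congr rfl fun i _ => ?_; ring)
    (fun a u v => by
      simp only [empMean, real_inner_smul_right, smul_eq_mul, Finset.mul_sum]
      refine Finset.sum_congr rfl fun i _ => ?_; ring)
    (fun u v v' => by
      simp only [empMean, inner_add_right, ← mul_add, ← Finset.sum_add_distrib])
    (fun a u v => by
      simp only [empMean, real_inner_smul_right, smul_eq_mul, Finset.mul_sum]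
      refine Finset.sum_congr rfl fun i _ => ?_; ring)

theorem sampleForm_apply (g : Fin m → E n) (c : E n → ℝ) (u v : E n) :
    sampleForm g c u v = empMean g fun x => c x * (inner ℝ x u * inner ℝ x v) := rfl

/-- The bilinear form `(u, v) ↦ ⟨A u, v⟩`. -/
def operatorForm (A : E n →L[ℝ] E n) : LinearMap.BilinForm ℝ (E n) :=
  (innerₗ (E n)).comp (A : E n →ₗ[ℝ] E n)

theorem operatorForm_apply (A : E n →L[ℝ] E n) (u v : E n) :
    operatorForm A u v = inner ℝ (A u) v := rfl

theorem isSymm_sampleForm_sub (g : Fin m → E n) (c : E n → ℝ) {A : E n →L[ℝ] E n}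
    (hA : ∀ u v, inner ℝ (A u) v = inner ℝ (A v) u) :
    (sampleForm g c - operatorForm A).IsSymm := by
  refine ⟨fun u v => ?_⟩
  simp only [LinearMap.sub_apply, sampleForm_apply, operatorForm_apply, hA u v,
    mul_comm (inner ℝ _ u)]

end

section

variable {m n : ℕ}

/-! ### From nets to subspaces -/

/-- The functions whose empirical means have to be close to their expectations at a triple
`u, r, s` of net points. -/
def testFun (δ t : ℝ) (u r s : E n) : Fin 6 → E n → ℝ :=
  ![fun x => both r s x * (inner ℝ x u) ^ 2, near δ r u, near δ s u, tail t u,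
    fun x => (inner ℝ x r) ^ 2, fun x => (inner ℝ x s) ^ 2]

theorem measurable_testFun (δ t : ℝ) (u r s : E n) (k : Fin 6) :
    Measurable (testFun δ t u r s k) := by
  have h1 := measurable_both r s
  fin_cases k
  · exact h1.mul (by fun_prop)
  · exact measurable_near δ r u
  · exact measurable_near δ s u
  · exact measurable_tail t u
  · change Measurable fun x : E n => (inner ℝ x r) ^ 2
    fun_prop
  · change Measurable fun x : E n => (inner ℝ x s) ^ 2
    fun_prop

theorem exists_abs_testFun_le (δ t : ℝ) {u r s : E n} (hu : ‖u‖ = 1) (hr : ‖r‖ = 1)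
    (hs : ‖s‖ = 1) (k : Fin 6) :
    ∃ y : E n, ‖y‖ = 1 ∧ ∀ x, |testFun δ t u r s k x| ≤ (inner ℝ x y) ^ 2 := by
  fin_cases k
  · refine ⟨u, hu, fun x => ?_⟩
    change |both r s x * (inner ℝ x u) ^ 2| ≤ _
    rw [abs_of_nonneg (mul_nonneg (both_nonneg r s x) (sq_nonneg _))]
    exact mul_le_of_le_one_left (sq_nonneg _) (both_le_one r s x)
  · exact ⟨u, hu, fun x => (abs_of_nonneg (near_nonneg δ r u x)).trans_le (near_le δ r u x)⟩
  · exact ⟨u, hu, fun x => (abs_of_nonneg (near_nonneg δ s u x)).trans_le (near_le δ s u x)⟩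
  · exact ⟨u, hu, fun x => (abs_of_nonneg (tail_nonneg t u x)).trans_le (tail_le t u x)⟩
  · exact ⟨r, hr, fun x => (abs_of_nonneg (sq_nonneg _)).le⟩
  · exact ⟨s, hs, fun x => (abs_of_nonneg (sq_nonneg _)).le⟩

/-- A sample which is nearly isotropic on a net of the unit sphere of `R` has second moments at
most `2` on `R`. -/
theorem empMean_sq_le {g : Fin m → E n} {R : Submodule ℝ (E n)} {N : Finset (E n)}
    (hN : ∀ r ∈ N, r ∈ R ∧ ‖r‖ = 1)
    (hnet : ∀ r ∈ R, ‖r‖ = 1 → ∃ r₀ ∈ N, ‖r - r₀‖ ≤ 1 / 4)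
    (h : ∀ r ∈ N, |(empMean g fun x => (inner ℝ x r) ^ 2) - 1| ≤ 1 / 2) {x : E n} (hx : x ∈ R) :
    (empMean g fun y => (inner ℝ y x) ^ 2) ≤ 2 * ‖x‖ ^ 2 := by
  set B := sampleForm g (fun _ => 1) - operatorForm (ContinuousLinearMap.id ℝ (E n))
  have hBs : B.IsSymm := isSymm_sampleForm_sub g _ fun u v => real_inner_comm v u
  have hB : ∀ y : E n, B y y = (empMean g fun z => (inner ℝ z y) ^ 2) - ‖y‖ ^ 2 := fun y => by
    simp only [B, LinearMap.sub_apply, sampleForm_apply, operatorForm_apply, one_mul,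
      ContinuousLinearMap.id_apply, real_inner_self_eq_norm_sq, sq]
  have := abs_bilin_self_le_of_net hBs hN hnet (η := 1 / 2)
    (fun r hr => by rw [hB, (hN r hr).2, one_pow]; exact h r hr) hx
  rw [hB] at this
  linarith [(abs_le.mp this).2]

/-- If the empirical means of the test functions are accurate at all net points, then the masked
Gram form is accurate on the whole of `T`, for all masks from `R` and `S`. The width `δ` and the
truncation level `t` balance `t² P(|Z| ≤ δ)` against the Gaussian tail `48 / t²`; the mesh
`δ ε / 512` makes `t² / δ²` times its square negligible. -/
theorem abs_empMean_sub_le_of_nets (hn : 2 ≤ n) {g : Fin m → E n} {ε δ t : ℝ} (hε : 0 < ε)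
    (hε1 : ε < 1) (hδ : δ = ε ^ 2 / 196608) (ht : 0 < t) (ht2 : t ^ 2 = 3072 / ε)
    {T R S : Submodule ℝ (E n)} {NT NR NS : Finset (E n)}
    (hT : ∀ u ∈ NT, u ∈ T ∧ ‖u‖ = 1) (hR : ∀ r ∈ NR, r ∈ R ∧ ‖r‖ = 1)
    (hS : ∀ s ∈ NS, s ∈ S ∧ ‖s‖ = 1)
    (hTn : ∀ u ∈ T, ‖u‖ = 1 → ∃ u₀ ∈ NT, ‖u - u₀‖ ≤ 1 / 4)
    (hRn : ∀ r ∈ R, ‖r‖ = 1 → ∃ r₀ ∈ NR, ‖r - r₀‖ ≤ δ * ε / 512)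
    (hSn : ∀ s ∈ S, ‖s‖ = 1 → ∃ s₀ ∈ NS, ‖s - s₀‖ ≤ δ * ε / 512)
    (hgood : ∀ u ∈ NT, ∀ r ∈ NR, ∀ s ∈ NS, ∀ k, |empMean g (testFun δ t u r s k) -
      ∫ x, testFun δ t u r s k x ∂(stdGaussian (E n))| < ε / 64)
    {r s : E n} (hr : r ∈ R) (hs : s ∈ S) (hr0 : r ≠ 0) (hs0 : s ≠ 0) {u : E n} (hu : u ∈ T) :
    |(empMean g fun x => both r s x * (inner ℝ x u * inner ℝ x u)) - inner ℝ (Q r s u) u|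
      ≤ ε * ‖u‖ ^ 2 := by
  set ν := stdGaussian (E n)
  have hδ0 : 0 < δ := by rw [hδ]; positivity
  have hδ1 : δ ≤ 1 := by rw [hδ]; nlinarith
  have hmesh : δ * ε / 512 ≤ 1 / 4 := by nlinarith
  set B := sampleForm g (both r s) - operatorForm (Q r s)
  have hBs : B.IsSymm := isSymm_sampleForm_sub g _ (inner_Q_comm r s)
  have hB : ∀ y : E n, B y y = (empMean g fun x => both r s x * (inner ℝ x y) ^ 2) -
      ∫ x, both r s x * (inner ℝ x y) ^ 2 ∂ν := fun y => by
    rw [integral_both_eq_inner_Q hn hr0 hs0]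
    simp only [B, LinearMap.sub_apply, sampleForm_apply, operatorForm_apply, sq]
  have hur := norm_unit hr0
  have hus := norm_unit hs0
  have hboth : ∀ x, both r s x = both (unit r) (unit s) x := fun x =>
    (both_smul (inv_pos.mpr (norm_pos_iff.mpr hr0)) (inv_pos.mpr (norm_pos_iff.mpr hs0)) r s x).symm
  obtain ⟨r₀, hr₀, hrr₀⟩ := hRn (unit r) (R.smul_mem _ hr) hur
  obtain ⟨s₀, hs₀, hss₀⟩ := hSn (unit s) (S.smul_mem _ hs) hus
  have hr₀1 := (hR r₀ hr₀).2
  have hs₀1 := (hS s₀ hs₀).2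
  -- the contribution of the vectors which move by more than `δ` along `r - r₀`
  have hshift : ∀ y : E n, ‖y‖ ≤ δ * ε / 512 → t ^ 2 / δ ^ 2 * ‖y‖ ^ 2 ≤ ε / 64 := fun y hy => by
    calc t ^ 2 / δ ^ 2 * ‖y‖ ^ 2 ≤ t ^ 2 / δ ^ 2 * (δ * ε / 512) ^ 2 := by gcongr
      _ = 3072 / 262144 * ε := by rw [ht2]; field_simp; norm_num
      _ ≤ ε / 64 := by linarith
  have htail : 48 / t ^ 2 = ε / 64 := by rw [ht2]; field_simp; norm_num
  have hnear : t ^ 2 * δ = ε / 64 := by rw [ht2, hδ]; field_simp; norm_num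
  have hη : ∀ u ∈ NT, |B u u| ≤ ε / 2 := by
    intro u hu
    have hu1 := (hT u hu).2
    have hempR : ∀ {x : E n}, x ∈ R → (empMean g fun y => (inner ℝ y x) ^ 2) ≤ 2 * ‖x‖ ^ 2 :=
      fun hx => empMean_sq_le hR
        (fun r hr h1 => (hRn r hr h1).imp fun _ h => ⟨h.1, h.2.trans hmesh⟩) (fun r hr => by
          have h := hgood u hu r hr s₀ hs₀ 4
          change |(empMean g fun x => (inner ℝ x r) ^ 2) - ∫ x : E n, (inner ℝ x r) ^ 2 ∂ν| < _ at h
          rw [integral_sq_inner, (hR r hr).2, one_pow] at h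
          linarith) hx
    have hempS : ∀ {x : E n}, x ∈ S → (empMean g fun y => (inner ℝ y x) ^ 2) ≤ 2 * ‖x‖ ^ 2 :=
      fun hx => empMean_sq_le hS
        (fun s hs h1 => (hSn s hs h1).imp fun _ h => ⟨h.1, h.2.trans hmesh⟩) (fun s hs => by
          have h := hgood u hu r₀ hr₀ s hs 5
          change |(empMean g fun x => (inner ℝ x s) ^ 2) - ∫ x : E n, (inner ℝ x s) ^ 2 ∂ν| < _ at h
          rw [integral_sq_inner, (hS s hs).2, one_pow] at h
          linarith) hx
    have h0 := hgood u hu r₀ hr₀ s₀ hs₀ 0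
    have h1 := hgood u hu r₀ hr₀ s₀ hs₀ 1
    have h2 := hgood u hu r₀ hr₀ s₀ hs₀ 2
    have h3 := hgood u hu r₀ hr₀ s₀ hs₀ 3
    change |(empMean g fun x => both r₀ s₀ x * (inner ℝ x u) ^ 2) -
      ∫ x, both r₀ s₀ x * (inner ℝ x u) ^ 2 ∂ν| < _ at h0
    change |empMean g (near δ r₀ u) - ∫ x, near δ r₀ u x ∂ν| < _ at h1
    change |empMean g (near δ s₀ u) - ∫ x, near δ s₀ u x ∂ν| < _ at h2
    change |empMean g (tail t u) - ∫ x, tail t u x ∂ν| < _ at h3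
    have hemp := abs_integral_both_sub_le hδ0 ht (μ := empMeasure g)
      (fun y => integrable_empMeasure g _) (unit r) r₀ (unit s) s₀ u
    simp only [integral_empMeasure] at hemp
    have hgau := abs_integral_both_sub_le hδ0 ht (μ := ν) integrable_sq_inner
      (unit r) r₀ (unit s) s₀ u
    simp only [ν, integral_sq_inner] at hgau
    have hnr := integral_near_le hδ0 ht hr₀1 hu1
    have hns := integral_near_le hδ0 ht hs₀1 hu1
    have htl := integral_tail_le hu1 ht
    have her := hempR (R.sub_mem (R.smul_mem ‖r‖⁻¹ hr) (hR r₀ hr₀).1)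
    have hes := hempS (S.sub_mem (S.smul_mem ‖s‖⁻¹ hs) (hS s₀ hs₀).1)
    change (empMean g fun y => (inner ℝ y (unit r - r₀)) ^ 2) ≤ 2 * ‖unit r - r₀‖ ^ 2 at her
    change (empMean g fun y => (inner ℝ y (unit s - s₀)) ^ 2) ≤ 2 * ‖unit s - s₀‖ ^ 2 at hes
    have hc : 0 ≤ t ^ 2 / δ ^ 2 := by positivity
    have her' := mul_le_mul_of_nonneg_left her hc
    have hes' := mul_le_mul_of_nonneg_left hes hc
    have hsr := hshift _ hrr₀
    have hss := hshift _ hss₀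
    rw [hB]
    simp only [hboth]
    rw [abs_lt] at h0 h1 h2 h3
    rw [abs_le] at hemp hgau ⊢
    simp only [mul_add] at hemp hgau
    constructor <;> linarith [h0.1, h0.2, h1.1, h1.2, h2.1, h2.2, h3.1, h3.2, hemp.1, hemp.2,
      hgau.1, hgau.2]
  have := abs_bilin_self_le_of_net hBs hT hTn hη hu
  refine le_trans (le_of_eq ?_) (this.trans (le_of_eq (by ring)))
  rfl

/-! ### The probability estimate -/

variable {Ω : Type*} [MeasurableSpace Ω] {P : Measure Ω} [IsProbabilityMeasure P]

/-- By polarization it suffices to consider `u = v`. If `r` or `s` is zero, both the mask and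
`Q r s` vanish. -/
theorem uniformBound_of_forall_self {W : Matrix (Fin m) (Fin n) ℝ} {ε : ℝ} (hε : 0 ≤ ε)
    {T R S : Submodule ℝ (E n)}
    (h : ∀ r ∈ R, ∀ s ∈ S, r ≠ 0 → s ≠ 0 → ∀ u ∈ T,
      |(empMean (row W) fun x => both r s x * (inner ℝ x u * inner ℝ x u)) - inner ℝ (Q r s u) u|
        ≤ ε * ‖u‖ ^ 2) :
    UniformBound W ε T T R S := by
  intro u hu v hv r hr s hs
  rw [inner_plus_eq]
  by_cases h0 : r = 0 ∨ s = 0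
  · have hb : ∀ x, both r s x = 0 := fun x => by
      rcases h0 with rfl | rfl <;> simp [both]
    have hQ : Q r s = 0 := if_pos h0
    simp only [hb, hQ, zero_mul, empMean, Finset.sum_const_zero, mul_zero, zero_apply,
      inner_zero_left, sub_self, abs_zero]
    positivity
  · push Not at h0
    exact abs_bilin_le (isSymm_sampleForm_sub (row W) (both r s) (inner_Q_comm r s))
      (h r hr s hs h0.1 h0.2) hu hv

/-- The failure probability for one triple of subspaces: a union bound over six test functions at
every triple of net points. The event need not be measurable; `P.real` is then its outer
probability. -/
theorem measureReal_not_uniformBound_le (hn : 2 ≤ n) {W : Ω → Matrix (Fin m) (Fin n) ℝ}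
    (hW : IsGaussianMatrix P W) {ε : ℝ} (hε : 0 < ε) (hε1 : ε < 1) {d : ℕ}
    {T R S : Submodule ℝ (E n)} (hT : Module.finrank ℝ T ≤ d) (hR : Module.finrank ℝ R ≤ d)
    (hS : Module.finrank ℝ S ≤ d) (hm : 0 < m) (hmd : 2 ^ 51 * ε⁻¹ ^ 5 * d ≤ m) :
    P.real {ω | ¬ UniformBound (W ω) ε T T R S} ≤ 12 * Real.exp (-(ε ^ 2 / 2 ^ 22 * m)) := by
  set δ : ℝ := ε ^ 2 / 196608 with hδ
  set t : ℝ := √(3072 / ε)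
  have hδ0 : 0 < δ := by positivity
  have ht : 0 < t := Real.sqrt_pos.mpr (by positivity)
  have ht2 : t ^ 2 = 3072 / ε := Real.sq_sqrt (by positivity)
  have hmesh : 0 < δ * ε / 512 := by positivity
  obtain ⟨NT, hNT, hcT, hTn⟩ := exists_net T (δ := 1 / 4) (by norm_num)
  obtain ⟨NR, hNR, hcR, hRn⟩ := exists_net R hmesh
  obtain ⟨NS, hNS, hcS, hSn⟩ := exists_net S hmesh
  set I := (NT ×ˢ NR ×ˢ NS) ×ˢ (Finset.univ : Finset (Fin 6))
  set bad : (E n × E n × E n) × Fin 6 → Set Ω := fun i =>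
    {ω | ε / 64 ≤ |empMean (fun k => row (W ω) k) (testFun δ t i.1.1 i.1.2.1 i.1.2.2 i.2) -
      ∫ x, testFun δ t i.1.1 i.1.2.1 i.1.2.2 i.2 x ∂(stdGaussian (E n))|}
  have hsub : {ω | ¬ UniformBound (W ω) ε T T R S} ⊆ ⋃ i ∈ I, bad i := by
    intro ω hω
    by_contra hc
    refine hω (uniformBound_of_forall_self hε.le fun r hr s hs hr0 hs0 u hu => ?_)
    refine abs_empMean_sub_le_of_nets hn hε hε1 hδ ht ht2 hNT hNR hNS hTn hRn hSn ?_
      hr hs hr0 hs0 hu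
    intro u hu r hr s hs k
    by_contra hk
    refine hc (Set.mem_biUnion (x := ((u, r, s), k)) ?_ (not_lt.mp hk))
    simp [I, hu, hr, hs]
  have hbad : ∀ i ∈ I, P.real (bad i) ≤ 2 * Real.exp (-((ε / 64) ^ 2 / 512 * m)) := by
    rintro ⟨⟨u, r, s⟩, k⟩ hi
    simp only [I, Finset.mem_product, Finset.mem_univ, and_true] at hi
    obtain ⟨y, hy, hyb⟩ := exists_abs_testFun_le δ t (hNT u hi.1).2 (hNR r hi.2.1).2
      (hNS s hi.2.2).2 k
    exact measure_le_abs_empMean_sub hm (hW.hasLaw_row hm) (hW.iIndepFun_row hm)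
      (measurable_testFun δ t u r s k) hy hyb
      (by positivity) (by linarith)
  have hcard : (I.card : ℝ) ≤ 6 * Real.exp (2 ^ 29 * ε⁻¹ ^ 3 * d) := by
    have hd : (0 : ℝ) ≤ d := Nat.cast_nonneg d
    have hmul : (I.card : ℝ) = 6 * (NT.card * (NR.card * NS.card)) := by
      simp [I, Finset.card_product]; ring
    rw [hmul]
    have hinv : 1 ≤ ε⁻¹ ^ 3 := one_le_pow₀ (one_le_inv₀ hε |>.mpr hε1.le)
    have h512 : 2 / (δ * ε / 512) = 201326592 * ε⁻¹ ^ 3 := by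
      rw [hδ]; field_simp; norm_num
    rw [h512] at hcR hcS
    have h1 : (2 : ℝ) / (1 / 4) * Module.finrank ℝ T ≤ 8 * ε⁻¹ ^ 3 * d := by
      have : (Module.finrank ℝ T : ℝ) ≤ d := by exact_mod_cast hT
      nlinarith
    have h2 : 201326592 * ε⁻¹ ^ 3 * Module.finrank ℝ R ≤ 201326592 * ε⁻¹ ^ 3 * d := by gcongr
    have h3 : 201326592 * ε⁻¹ ^ 3 * Module.finrank ℝ S ≤ 201326592 * ε⁻¹ ^ 3 * d := by gcongr
    calc (6 : ℝ) * (NT.card * (NR.card * NS.card))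
        ≤ 6 * (Real.exp (2 / (1 / 4) * Module.finrank ℝ T) *
          (Real.exp (201326592 * ε⁻¹ ^ 3 * Module.finrank ℝ R) *
            Real.exp (201326592 * ε⁻¹ ^ 3 * Module.finrank ℝ S))) := by gcongr
      _ ≤ 6 * Real.exp (2 ^ 29 * ε⁻¹ ^ 3 * d) := by
        rw [← Real.exp_add, ← Real.exp_add]
        gcongr
        nlinarith [mul_nonneg (zero_le_one.trans hinv) hd]
  calc P.real {ω | ¬ UniformBound (W ω) ε T T R S}
      ≤ P.real (⋃ i ∈ I, bad i) := measureReal_mono hsub (measure_ne_top _ _)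
    _ ≤ ∑ i ∈ I, P.real (bad i) := measureReal_biUnion_finset_le I bad
    _ ≤ I.card * (2 * Real.exp (-((ε / 64) ^ 2 / 512 * m))) := by
      rw [← nsmul_eq_mul]
      exact Finset.sum_le_card_nsmul _ _ _ hbad
    _ ≤ 6 * Real.exp (2 ^ 29 * ε⁻¹ ^ 3 * d) * (2 * Real.exp (-((ε / 64) ^ 2 / 512 * m))) := by
      gcongr
    _ = 12 * Real.exp (2 ^ 29 * ε⁻¹ ^ 3 * d + -((ε / 64) ^ 2 / 512 * m)) := by
      rw [Real.exp_add]; ring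
    _ ≤ 12 * Real.exp (-(ε ^ 2 / 2 ^ 22 * m)) := by
      gcongr
      -- half of the exponent of the concentration bound pays for the nets
      have h : 2 ^ 29 * ε⁻¹ ^ 3 * d ≤ ε ^ 2 / 2 ^ 22 * m := by
        calc 2 ^ 29 * ε⁻¹ ^ 3 * d = ε ^ 2 / 2 ^ 22 * (2 ^ 51 * ε⁻¹ ^ 5 * d) := by
              field_simp
          _ ≤ ε ^ 2 / 2 ^ 22 * m := by gcongr
      linarith

/-- A union bound for inner probabilities. The measurable event required by
`HoldsWithProbExceeding` is the complement of a measurable hull of the exceptional set. -/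
theorem holdsWithProbExceeding_forall {ι : Type*} [Fintype ι] {A : ι → Ω → Prop} {b p : ℝ}
    (hA : ∀ i, P.real {ω | ¬ A i ω} ≤ b) (hp : p < 1 - Fintype.card ι * b) :
    HoldsWithProbExceeding P (fun ω => ∀ i, A i ω) p := by
  set D := ⋃ i, {ω | ¬ A i ω}
  refine ⟨(toMeasurable P D)ᶜ, (measurableSet_toMeasurable P D).compl, fun ω hω i => ?_, ?_⟩
  · by_contra hc
    exact hω (subset_toMeasurable P D (Set.mem_iUnion.mpr ⟨i, hc⟩))
  · have h1 : P.real (toMeasurable P D) ≤ Fintype.card ι * b := by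
      rw [Measure.real, measure_toMeasurable]
      change P.real D ≤ _
      refine (measureReal_iUnion_fintype_le _).trans ?_
      rw [← nsmul_eq_mul, ← Finset.card_univ]
      exact Finset.sum_le_card_nsmul _ _ _ fun i _ => hA i
    rw [probReal_compl_eq_one_sub (measurableSet_toMeasurable P D)]
    linarith

theorem one_le_exp_mul_div_pow {l m : ℕ} (hl : 1 ≤ l) (hlm : l ≤ m) :
    1 ≤ (Real.exp 1 * m / l) ^ (2 * l) := by
  refine one_le_pow₀ ?_
  have hl' : (0 : ℝ) < l := by exact_mod_cast hl
  have hlm' : (l : ℝ) ≤ m := by exact_mod_cast hlm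
  rw [le_div_iff₀ hl', one_mul]
  have := Real.one_le_exp (zero_le_one (α := ℝ))
  nlinarith

end

end ReluConcentration

end

theorem proposition3p2 :
    -- `γ` is an absolute constant, `c_ε = c(ε)` and `C_ε = C(ε⁻¹)` with fixed polynomials `c`, `C`
    ∃ (γ : ℝ) (c C : Polynomial ℝ), 0 < γ ∧
      (∀ ε : ℝ, 0 < ε → ε < 1 → 0 < c.eval ε ∧ 0 < C.eval ε⁻¹) ∧
      ∀ (ε : ℝ), 0 < ε → ε < 1 →
      ∀ (m n l l' : ℕ), 1 ≤ l → l < n → l ≤ l' →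
      ∀ (Ω : Type*) [MeasurableSpace Ω] (P : Measure Ω) [IsProbabilityMeasure P]
        (W : Ω → Matrix (Fin m) (Fin n) ℝ), ReluConcentration.IsGaussianMatrix P W →
      -- the bound on fixed subspaces
      ((∀ (R S T : Submodule ℝ (ReluConcentration.E n)),
          Module.finrank ℝ R = l → Module.finrank ℝ S = l → Module.finrank ℝ T = l' →
          C.eval ε⁻¹ * l' ≤ m →
          ReluConcentration.HoldsWithProbExceeding P
            (fun ω => ReluConcentration.UniformBound (W ω) ε T T R S)
            (1 - γ * (Real.exp 1 * m / l) ^ (2 * l) * Real.exp (-(c.eval ε * m)))) ∧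
      -- the bound on unions of subspaces
      (∀ (N₁ N₂ N₃ N₄ : ℕ), 1 ≤ N₁ → 1 ≤ N₂ → 1 ≤ N₃ → 1 ≤ N₄ →
        ∀ (U : Fin N₁ → Submodule ℝ (ReluConcentration.E n))
          (V : Fin N₂ → Submodule ℝ (ReluConcentration.E n))
          (R : Fin N₃ → Submodule ℝ (ReluConcentration.E n))
          (S : Fin N₄ → Submodule ℝ (ReluConcentration.E n)),
          (∀ i, Module.finrank ℝ (U i) ≤ l') → (∀ j, Module.finrank ℝ (V j) ≤ l') →
          (∀ p, Module.finrank ℝ (R p) ≤ l) → (∀ q, Module.finrank ℝ (S q) ≤ l) →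
          2 * C.eval ε⁻¹ * l' ≤ m →
          ReluConcentration.HoldsWithProbExceeding P
            (fun ω => ReluConcentration.UniformBound (W ω) ε
              (⋃ i, (U i : Set (ReluConcentration.E n))) (⋃ j, (V j : Set (ReluConcentration.E n)))
              (⋃ p, (R p : Set (ReluConcentration.E n))) (⋃ q, (S q : Set (ReluConcentration.E n))))
            (1 - γ * (N₁ * N₂ * N₃ * N₄) * (Real.exp 1 * m / l) ^ (2 * l)
              * Real.exp (-(c.eval ε * m))))) := by
  have hC : ∀ ε : ℝ, (Polynomial.C (2 ^ 51 : ℝ) * Polynomial.X ^ 5).eval ε⁻¹ = 2 ^ 51 * ε⁻¹ ^ 5 :=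
    fun ε => by simp
  have hc : ∀ ε : ℝ, (Polynomial.C ((2 ^ 22)⁻¹ : ℝ) * Polynomial.X ^ 2).eval ε = ε ^ 2 / 2 ^ 22 :=
    fun ε => by simp; ring
  -- `13` exceeds the constant `12` of the failure bound, which makes the inequalities strict
  refine ⟨13, Polynomial.C (2 ^ 22)⁻¹ * Polynomial.X ^ 2, Polynomial.C (2 ^ 51) * Polynomial.X ^ 5,
    by norm_num, fun ε hε _ => ⟨by rw [hc]; positivity, by rw [hC]; positivity⟩, ?_⟩
  intro ε hε hε1 m n l l' hl hln hll' Ω _ P _ W hW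
  rw [hc, hC]
  have hl' : (1 : ℝ) ≤ l' := by exact_mod_cast hl.trans hll'
  have hK : (1 : ℝ) ≤ 2 ^ 51 * ε⁻¹ ^ 5 := by
    have : 1 ≤ ε⁻¹ ^ 5 := one_le_pow₀ (one_le_inv₀ hε |>.mpr hε1.le)
    linarith
  have hlm : 2 ^ 51 * ε⁻¹ ^ 5 * l' ≤ m → l ≤ m ∧ 0 < m := fun h => by
    have h1 : l' ≤ m := by
      have : (l' : ℝ) ≤ m := by nlinarith
      exact_mod_cast this
    omega
  have he := Real.exp_pos (-(ε ^ 2 / 2 ^ 22 * m))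
  constructor
  · intro R S T hR hS hT hm
    obtain ⟨h1, h2⟩ := hlm hm
    have hpow := ReluConcentration.one_le_exp_mul_div_pow hl h1
    obtain ⟨F, hF, hFA, hFp⟩ := ReluConcentration.holdsWithProbExceeding_forall (ι := Unit)
      (A := fun _ ω => ReluConcentration.UniformBound (W ω) ε T T R S)
      (p := 1 - 13 * (Real.exp 1 * m / l) ^ (2 * l) * Real.exp (-(ε ^ 2 / 2 ^ 22 * m)))
      (fun _ => ReluConcentration.measureReal_not_uniformBound_le (by omega) hW hε hε1 hT.le
        (hR.trans_le hll')
        (hS.trans_le hll') h2 hm) (by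
          simp only [Fintype.card_unit, Nat.cast_one, one_mul]
          nlinarith)
    exact ⟨F, hF, fun ω hω => hFA ω hω (), hFp⟩
  · intro N₁ N₂ N₃ N₄ hN₁ hN₂ hN₃ hN₄ U V R S hU hV hR hS hm
    obtain ⟨h1, h2⟩ := hlm (by nlinarith)
    have hpow := ReluConcentration.one_le_exp_mul_div_pow hl h1
    obtain ⟨F, hF, hFA, hFp⟩ := ReluConcentration.holdsWithProbExceeding_forall
      (ι := Fin N₁ × Fin N₂ × Fin N₃ × Fin N₄)
      (A := fun i ω => ReluConcentration.UniformBound (W ω) ε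
        (U i.1 ⊔ V i.2.1 : Submodule ℝ (ReluConcentration.E n))
        (U i.1 ⊔ V i.2.1 : Submodule ℝ (ReluConcentration.E n)) (R i.2.2.1) (S i.2.2.2))
      (p := 1 - 13 * (N₁ * N₂ * N₃ * N₄) * (Real.exp 1 * m / l) ^ (2 * l) *
        Real.exp (-(ε ^ 2 / 2 ^ 22 * m)))
      (fun i => ReluConcentration.measureReal_not_uniformBound_le (d := 2 * l') (by omega) hW hε hε1
        ((Submodule.finrank_add_le_finrank_add_finrank _ _).trans
          (by linarith [hU i.1, hV i.2.1]))
        ((hR _).trans (by omega)) ((hS _).trans (by omega)) h2 (by push_cast; linarith)) (by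
          simp only [Fintype.card_prod, Fintype.card_fin, Nat.cast_mul]
          have hN : (0 : ℝ) < N₁ * N₂ * N₃ * N₄ := by
            have : 0 < N₁ * N₂ * N₃ * N₄ := by positivity
            exact_mod_cast this
          have := mul_pos hN he
          nlinarith)
    refine ⟨F, hF, fun ω hω u hu v hv r hr s hs => ?_, hFp⟩
    obtain ⟨i, hu⟩ := Set.mem_iUnion.mp hu
    obtain ⟨j, hv⟩ := Set.mem_iUnion.mp hv
    obtain ⟨p, hr⟩ := Set.mem_iUnion.mp hr
    obtain ⟨q, hs⟩ := Set.mem_iUnion.mp hs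
    exact hFA ω hω (i, j, p, q) u (Submodule.mem_sup_left hu) v (Submodule.mem_sup_right hv)
      r hr s hs
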